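/- \textbf{Theorem (perturbed Hamiltonian Noether theorem).} Let $M\subset X\times U=\mathbb{R}^p\times\mathbb{R}^q$ be a fixed connected open set of independent and dependent variables $(x,u)$, let $t$ range over an open interval, let $\varepsilon$ be a small parameter, $|\varepsilon|<\varepsilon_0$, and fix an order of precision $k\ge 0$. A \emph{differential function} is a smooth function $F(x,t,u^{(n)},\varepsilon)$ of $x$, $t$, $\varepsilon$ and finitely many $x$-derivatives $u^\alpha_J$ of $u$, with $(x,u)\in M$; $D_i$ are the total $x$-derivatives, $D_J$ their iterates, $\mathbf{Div}\,X=\sum_i D_iX_i$, $\mathbf{E}_\alpha=\sum_J(-D)_J\,\partial/\partial u^\alpha_J$ is the Euler operator, and $\mathbf{pr\,v}_Q=\sum_{\alpha,J}D_JQ_\alpha\,\partial/\partial u^\alpha_J$ is the prolonged evolutionary vector field with characteristic $Q$. We write $F\approx G$ if $F-G=o(\varepsilon^k)$ as $\varepsilon\to 0$ for all values of the other variables. Functionals $\mathscr{P}=\int P\,dx$ are represented by differential functions $P$, with $\int P\,dx\approx\int L\,dx$ if $P-L\approx\mathbf{Div}\,X$ for some $p$-tuple $X$ of differential functions, and $\delta\mathscr{P}=\mathbf{E}(P)$.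 Let $\mathscr{D}=\big(\sum_J \mathscr{D}_{\alpha\beta,J}[u,\varepsilon]\,D_J\big)$ be a $q\times q$ matrix of differential operators of finite order whose coefficients are differential functions not depending explicitly on $t$, and let $\mathscr{D}$ be approximately Hamiltonian: the bracket $\{\mathscr{P},\mathscr{L}\}=\int\delta\mathscr{P}\cdot\mathscr{D}\delta\mathscr{L}\,dx$ on functionals is skew-symmetric and satisfies the Jacobi identity up to $\approx$. Let $\mathscr{H}=\int H[u,\varepsilon]\,dx$ be a functional whose density does not depend explicitly on $t$, let $K=\mathscr{D}\delta\mathscr{H}$, and consider the perturbed Hamiltonian system $u_t=K$. On its solutions the total time derivative is $D_tF=\partial_tF+\mathbf{pr\,v}_K(F)$. An evolutionary vector field $\mathbf{v}_Q$ is (the infinitesimal generator of) an \emph{approximate generalized symmetry group} of the system if $D_tQ_\nu\approx\mathbf{pr\,v}_Q(K_\nu)$ for $\nu=1,\dots,q$. A functional $\int T\,dx$ is an \emph{approximate conservation law} if $D_tT+\mathbf{Div}\,X\approx 0$ for some $p$-tuple $X$ of differential functions. A functional $\mathscr{G}[t;u,\varepsilon]$, possibly depending on $t$, is an \emph{approximate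 distinguished functional} for $\mathscr{D}$ if $\mathscr{D}\delta\mathscr{G}\approx 0$. Then for every functional $\mathscr{P}=\int P(x,t,u^{(n)},\varepsilon)\,dx$, the Hamiltonian vector field $\hat{\mathbf{v}}_{\mathscr{P}}$ with characteristic $\mathscr{D}\delta\mathscr{P}$ determines an approximate generalized symmetry group of $u_t=\mathscr{D}\delta\mathscr{H}$ if and only if there are a (time-dependent) approximate distinguished functional $\mathscr{G}[t;u,\varepsilon]$ and a functional $\tilde{\mathscr{P}}\approx\mathscr{P}-\mathscr{G}$ such that $\tilde{\mathscr{P}}$ determines an approximate conservation law of the system. -/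

import Mathlib

open scoped ContDiff Topology

noncomputable section

namespace PerturbedHamiltonian

/-- Multi-indices in `p` spatial directions; `J i` counts the derivatives in direction `i`. -/
abbrev MultiIndex (p : ℕ) : Type := Fin p → ℕ

/-- The coordinates of the infinite jet space with parameters: the time `t`, the independent
variables `x^i`, the (spatial) jet variables `u^α_J`, and the perturbation parameter `ε`. -/
inductive Coord (p q : ℕ) : Type
  | time : Coord p q
  | space (i : Fin p) : Coord p q
  | jet (α : Fin q) (J : MultiIndex p) : Coord p q
  | eps : Coord p q
  deriving DecidableEq

/-- Points `(t, x, u^{(∞)}, ε)`. -/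
abbrev JetPoint (p q : ℕ) : Type := Coord p q → ℝ

/-- Real functions of `(t, x, u^{(∞)}, ε)`. -/
abbrev JetFun (p q : ℕ) : Type := JetPoint p q → ℝ

/-- The fixed domain: a connected open set `M ⊆ X × U` of the variables `(x, u)`, an open time
interval and a range `|ε| < ε₀` of the small parameter. The derivative coordinates are free. -/
structure Domain (p q : ℕ) where
  M : Set ((Fin p → ℝ) × (Fin q → ℝ))
  isOpen_M : IsOpen M
  isConnected_M : IsConnected M
  T : Set ℝ
  isOpen_T : IsOpen T
  isConnected_T : IsConnected T
  eps0 : ℝ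
  eps0_pos : 0 < eps0

/-- The part of the jet space that lies over the domain. -/
def Domain.carrier {p q : ℕ} (Ω : Domain p q) : Set (JetPoint p q) :=
  {z | z .time ∈ Ω.T ∧
    ((fun i => z (.space i), fun α => z (.jet α 0)) : (Fin p → ℝ) × (Fin q → ℝ)) ∈ Ω.M ∧
    |z .eps| < Ω.eps0}

/-- `F` is a differential function over the domain: it depends on finitely many of
the coordinates, and smoothly on these. (Projections are open maps, so the image is open.) -/
def IsDiffFun {p q : ℕ} (Ω : Domain p q) (F : JetFun p q) : Prop :=
  ∃ (S : Finset (Coord p q)) (f : (S → ℝ) → ℝ),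
    ContDiffOn ℝ ∞ f ((fun (z : JetPoint p q) (c : S) => z c) '' Ω.carrier) ∧
    ∀ z ∈ Ω.carrier, F z = f (fun c : S => z c)

/-- `F` does not depend explicitly on the time `t`. -/
def IsAutonomous {p q : ℕ} (Ω : Domain p q) (F : JetFun p q) : Prop :=
  ∀ z ∈ Ω.carrier, ∀ t ∈ Ω.T, F (Function.update z .time t) = F z

/-- `F = o(ε^k)` as `ε → 0`, for all values of the other variables. -/
def IsLittleO {p q : ℕ} (Ω : Domain p q) (k : ℕ) (F : JetFun p q) : Prop :=
  ∀ z ∈ Ω.carrier, (fun ε : ℝ => F (Function.update z .eps ε)) =o[𝓝 0] (fun ε : ℝ => ε ^ k)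

/-- The partial derivative `∂F/∂c` with respect to the coordinate `c`. -/
def pd {p q : ℕ} (c : Coord p q) (F : JetFun p q) : JetFun p q :=
  fun z => deriv (fun s : ℝ => F (Function.update z c s)) (z c)

/-- The total derivative `D_i F = ∂F/∂x^i + ∑_{α,J} u^α_{J,i} ∂F/∂u^α_J`. -/
def totalD {p q : ℕ} (i : Fin p) (F : JetFun p q) : JetFun p q :=
  fun z => pd (.space i) F z +
    ∑ α : Fin q, ∑ᶠ J : MultiIndex p, z (.jet α (J + Pi.single i 1)) * pd (.jet α J) F z

/-- The iterated total derivative `D_J = D_1^{J_1} ⋯ D_p^{J_p}`. -/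
def totalDJ {p q : ℕ} (J : MultiIndex p) (F : JetFun p q) : JetFun p q :=
  (List.finRange p).foldr (fun i G => (totalD i)^[J i] G) F

/-- The total (spatial) divergence `Div X = ∑_i D_i X_i`. -/
def totalDiv {p q : ℕ} (X : Fin p → JetFun p q) : JetFun p q :=
  fun z => ∑ i, totalD i (X i) z

/-- The prolonged evolutionary vector field with characteristic `Q` applied to `F`:
`pr v_Q (F) = ∑_{α,J} (D_J Q_α) ∂F/∂u^α_J`. -/
def prEvol {p q : ℕ} (Q : Fin q → JetFun p q) (F : JetFun p q) : JetFun p q :=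
  fun z => ∑ α : Fin q, ∑ᶠ J : MultiIndex p, totalDJ J (Q α) z * pd (.jet α J) F z

/-- The total time derivative `D_t F = ∂F/∂t + ∑_{α,J} u^α_{J,t} ∂F/∂u^α_J` on the solutions of
the evolution system `u_t = K`, that is, with `u^α_{J,t} = D_J K_α` substituted. -/
def totalDt {p q : ℕ} (K : Fin q → JetFun p q) (F : JetFun p q) : JetFun p q :=
  fun z => pd .time F z +
    ∑ α : Fin q, ∑ᶠ J : MultiIndex p, totalDJ J (K α) z * pd (.jet α J) F z

/-- The Euler operator, i.e. the variational derivative of the functional `∫ F dx`: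
`(δ ∫ F dx)_α = E_α(F) = ∑_J (-D)_J ∂F/∂u^α_J`. -/
def euler {p q : ℕ} (F : JetFun p q) : Fin q → JetFun p q :=
  fun α z => ∑ᶠ J : MultiIndex p, (-1 : ℝ) ^ (∑ i, J i) * totalDJ J (pd (.jet α J) F) z

/-- The coefficients of a `q × q` matrix of differential operators: the entry `(α, β)` is
`∑_J 𝒟_{αβ,J} D_J`, a finite sum. -/
abbrev MatDiffOp (p q : ℕ) : Type := Fin q → Fin q → (MultiIndex p →₀ JetFun p q)

/-- The action of a matrix differential operator on a `q`-tuple of differential functions. -/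
def MatDiffOp.apply {p q : ℕ} (𝒟 : MatDiffOp p q) (Q : Fin q → JetFun p q) :
    Fin q → JetFun p q :=
  fun α z => ∑ β : Fin q, (𝒟 α β).sum fun J c => c z * totalDJ J (Q β) z

/-- The coefficients are differential functions of `(x, u^{(n)}, ε)`, without explicit `t`. -/
def IsMatDiffOp {p q : ℕ} (Ω : Domain p q) (𝒟 : MatDiffOp p q) : Prop :=
  ∀ α β J, IsDiffFun Ω (𝒟 α β J) ∧ IsAutonomous Ω (𝒟 α β J)

/-- `∫ F dx = ∫ G dx + o(ε^k)`: functionals are represented by their densities, which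
are determined up to total divergences. -/
def FunctionalApprox {p q : ℕ} (Ω : Domain p q) (k : ℕ) (F G : JetFun p q) : Prop :=
  ∃ X : Fin p → JetFun p q, (∀ i, IsDiffFun Ω (X i)) ∧
    IsLittleO Ω k (fun z => F z - G z - totalDiv X z)

/-- The density of the bracket `{∫ P dx, ∫ L dx} = ∫ δP · 𝒟 δL dx`. -/
def bracket {p q : ℕ} (𝒟 : MatDiffOp p q) (P L : JetFun p q) : JetFun p q :=
  fun z => ∑ α : Fin q, euler P α z * 𝒟.apply (euler L) α z

/-- `𝒟` is an approximate Hamiltonian operator: on the space of functionals, its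
bracket is skew-symmetric and satisfies the Jacobi identity, up to `o(ε^k)`. -/
structure IsApproxHamiltonianOp {p q : ℕ} (Ω : Domain p q) (k : ℕ) (𝒟 : MatDiffOp p q) :
    Prop where
  isMatDiffOp : IsMatDiffOp Ω 𝒟
  skew : ∀ P L : JetFun p q, IsDiffFun Ω P → IsDiffFun Ω L →
    FunctionalApprox Ω k (bracket 𝒟 P L) (fun z => -bracket 𝒟 L P z)
  jacobi : ∀ P L R : JetFun p q, IsDiffFun Ω P → IsDiffFun Ω L → IsDiffFun Ω R →
    FunctionalApprox Ω k
      (fun z => bracket 𝒟 (bracket 𝒟 P L) R z + bracket 𝒟 (bracket 𝒟 L R) P z +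
        bracket 𝒟 (bracket 𝒟 R P) L z)
      (fun _ => 0)

/-- The evolutionary vector field with characteristic `Q` is an approximate generalized
symmetry of `u_t = K`: `D_t Q_ν = pr v_Q (K_ν) + o(ε^k)` on solutions. -/
def IsApproxSymmetry {p q : ℕ} (Ω : Domain p q) (k : ℕ) (K Q : Fin q → JetFun p q) : Prop :=
  ∀ ν : Fin q, IsLittleO Ω k (fun z => totalDt K (Q ν) z - prEvol Q (K ν) z)

/-- `∫ F dx` determines an approximate conservation law of `u_t = K`:
`D_t F + Div X = o(ε^k)` on solutions, for some flux `X`. -/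
def IsApproxConservationLaw {p q : ℕ} (Ω : Domain p q) (k : ℕ) (K : Fin q → JetFun p q)
    (F : JetFun p q) : Prop :=
  ∃ X : Fin p → JetFun p q, (∀ i, IsDiffFun Ω (X i)) ∧
    IsLittleO Ω k (fun z => totalDt K F z + totalDiv X z)

/-- `∫ G dx` is an approximate distinguished functional for `𝒟`: `𝒟 δG = o(ε^k)`. It may depend
explicitly on `t`. -/
def IsApproxDistinguished {p q : ℕ} (Ω : Domain p q) (k : ℕ) (𝒟 : MatDiffOp p q)
    (G : JetFun p q) : Prop :=
  ∀ α : Fin q, IsLittleO Ω k (𝒟.apply (euler G) α)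

end PerturbedHamiltonian

end

open scoped ContDiff Topology

noncomputable section

namespace PerturbedHamiltonian

/-! ### Multi-indices -/

/-! Differential functions modulo `o(ε^k)` form a commutative algebra on which every partial
derivative except `∂/∂ε` acts. Indeed, by smoothness, `F = o(ε^k)` says that the Taylor coefficients
of `F` in `ε` up to order `k` vanish (`isLittleO_pow_iff`, `isLittleO_iff`), and the other
derivatives commute with `∂/∂ε`. In this quotient all approximate relations become exact, so the
theorem is proved once for an abstract `JetAlgebra` (`JetAlgebra.noether`) and then transported
through the relation `Rep`.

Write `δ` for the Euler operator, `Q_F = 𝒟 δF`, and `≡` for equality modulo total divergences.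
Integration by parts gives `pr v_{Q_L}(P) ≡ {P, L}` (`pr_sub_bracket_mem`). Skew-symmetry and the
Jacobi identity then show that the characteristic of the commutator of the fields of `H` and `P`
pairs with every `δR` like `𝒟 δ{P, H}`. Such pairings determine a characteristic
(`eq_zero_of_pairing_mem`), so the two are equal (`hamiltonian_commutator`). Since the coefficients
of `𝒟` are free of `t`, the symmetry condition reads `𝒟 δ(∂_t P + {P, H}) = 0`: the functional `L =
∂_t P + {P, H}` is distinguished.

Given a symmetry, let `G` be the time primitive of `L` vanishing at some `t₀`. Then `𝒟 δG` vanishes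
at `t₀` and has time derivative `𝒟 δL = 0`, so `G` is distinguished. Hence `pr v_{Q_H}(G) ≡ {G, H} ≡
-{H, G} = 0`, and `D_t(P - G) ≡ L - ∂_t G = 0`. Conversely, if `P - G` is conserved with `G`
distinguished, the same computation gives `L ≡ ∂_t G`, so `𝒟 δL = ∂_t(𝒟 δG) = 0`. -/

theorem MultiIndex.induction {p : ℕ} {C : MultiIndex p → Prop} (zero : C 0)
    (succ : ∀ J i, C J → C (J + Pi.single i 1)) (J : MultiIndex p) : C J := by
  obtain ⟨n, hn⟩ : ∃ n, ∑ i, J i = n := ⟨_, rfl⟩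
  induction n generalizing J with
  | zero =>
    have : J = 0 := by
      ext i
      have := Finset.sum_eq_zero_iff.1 hn i (Finset.mem_univ i)
      simpa using this
    rwa [this]
  | succ n ih =>
    obtain ⟨i, -, hi⟩ : ∃ i ∈ Finset.univ, J i ≠ 0 := by
      by_contra! h
      rw [Finset.sum_eq_zero h] at hn
      omega
    have hJ : J - Pi.single i 1 + Pi.single i 1 = J := by
      ext j
      by_cases hj : j = i
      · subst hj; simp; omega
      · simp [hj]
    rw [← hJ]
    apply succ
    apply ih
    have : ∑ j, (J - Pi.single i 1 + Pi.single i 1 : MultiIndex p) j = n + 1 := by rw [hJ, hn]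
    simp only [Pi.add_apply, Finset.sum_add_distrib, Finset.sum_pi_single', Finset.mem_univ,
      if_true] at this
    omega

theorem MultiIndex.exists_eq_add_single {p : ℕ} {J : MultiIndex p} {i : Fin p} (h : J i ≠ 0) :
    ∃ J' : MultiIndex p, J = J' + Pi.single i 1 := by
  refine ⟨J - Pi.single i 1, ?_⟩
  ext j
  by_cases hj : j = i
  · subst hj; simp; omega
  · simp [hj]

theorem MultiIndex.sum_add_single {p : ℕ} (J : MultiIndex p) (i : Fin p) :
    ∑ j, (J + Pi.single i 1 : MultiIndex p) j = ∑ j, J j + 1 := by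
  simp [Finset.sum_add_distrib]

/-! ### Algebras of differential functions -/

/-- A commutative algebra with commuting, locally finite partial derivatives with respect to the
jet coordinates, and with an ideal of elements vanishing at an initial time from which one can
integrate in time. -/
structure JetAlgebra (p q : ℕ) (B : Type*) [CommRing B] [Algebra ℝ B] where
  d : Coord p q → Derivation ℝ B B
  coord : Coord p q → B
  -- The derivative in `ε` is exempt: it does not preserve `o(ε^k)`, and the model below sets it to
  -- zero.
  d_coord : ∀ c e, c ≠ .eps → d c (coord e) = if c = e then 1 else 0
  d_comm : ∀ c e f, d c (d e f) = d e (d c f)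
  finite_support : ∀ f, {c | d c f ≠ 0}.Finite
  initial : Ideal B
  d_mem_initial : ∀ c, c ≠ .time → ∀ f ∈ initial, d c f ∈ initial
  eq_zero_of_mem_initial : ∀ f ∈ initial, d .time f = 0 → f = 0
  exists_primitive : ∀ f, ∃ g ∈ initial, d .time g = f

namespace JetAlgebra

variable {p q : ℕ} {B : Type*} [CommRing B] [Algebra ℝ B] (𝒥 : JetAlgebra p q B)

/-- The partial derivative with respect to a jet variable. -/
def dj (s : Fin q × MultiIndex p) : Derivation ℝ B B := 𝒥.d (.jet s.1 s.2)

/-- The jet variable. -/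
def u (s : Fin q × MultiIndex p) : B := 𝒥.coord (.jet s.1 s.2)

theorem dj_u (r s : Fin q × MultiIndex p) : 𝒥.dj r (𝒥.u s) = if r = s then 1 else 0 := by
  rw [dj, u, 𝒥.d_coord _ _ (by simp)]
  congr 1
  simp [Prod.ext_iff]

theorem d_dj (c : Coord p q) (s : Fin q × MultiIndex p) (f : B) :
    𝒥.d c (𝒥.dj s f) = 𝒥.dj s (𝒥.d c f) :=
  𝒥.d_comm _ _ _

theorem dj_comm (r s : Fin q × MultiIndex p) (f : B) :
    𝒥.dj r (𝒥.dj s f) = 𝒥.dj s (𝒥.dj r f) :=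
  𝒥.d_comm _ _ _

theorem exists_support (f : B) :
    ∃ S : Finset (Fin q × MultiIndex p), ∀ s ∉ S, 𝒥.dj s f = 0 := by
  have h := (𝒥.finite_support f).preimage
    (f := fun s : Fin q × MultiIndex p => Coord.jet s.1 s.2) (by
      intro a _ b _ hab
      simp only [Coord.jet.injEq] at hab
      exact Prod.ext hab.1 hab.2)
  refine ⟨h.toFinset, fun s hs => ?_⟩
  simpa [dj] using hs

theorem exists_support₂ (f g : B) :
    ∃ S : Finset (Fin q × MultiIndex p), (∀ s ∉ S, 𝒥.dj s f = 0) ∧ ∀ s ∉ S, 𝒥.dj s g = 0 := by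
  classical
  obtain ⟨S, hS⟩ := 𝒥.exists_support f
  obtain ⟨T, hT⟩ := 𝒥.exists_support g
  refine ⟨S ∪ T, fun s hs => hS s ?_, fun s hs => hT s ?_⟩ <;> simp_all

theorem exists_jet_support (f : B) :
    ∃ T : Finset (MultiIndex p), ∀ α, ∀ J ∉ T, 𝒥.dj (α, J) f = 0 := by
  classical
  obtain ⟨S, hS⟩ := 𝒥.exists_support f
  refine ⟨S.image Prod.snd, fun α J hJ => hS _ fun h => hJ ?_⟩
  exact Finset.mem_image_of_mem _ h

/-- The vertical vector field `∑ a^α_J ∂/∂u^α_J` applied to an element. -/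
def vertFun (a : Fin q × MultiIndex p → B) (f : B) : B := ∑ᶠ s, a s * 𝒥.dj s f

theorem vertFun_eq_sum (a : Fin q × MultiIndex p → B) {f : B}
    {S : Finset (Fin q × MultiIndex p)} (hS : ∀ s ∉ S, 𝒥.dj s f = 0) :
    𝒥.vertFun a f = ∑ s ∈ S, a s * 𝒥.dj s f := by
  apply finsum_eq_sum_of_support_subset
  intro s hs
  by_contra h
  exact hs (by simp [hS s h])

/-- The vertical vector field `∑ a^α_J ∂/∂u^α_J`. -/
def vert (a : Fin q × MultiIndex p → B) : Derivation ℝ B B where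
  toFun := 𝒥.vertFun a
  map_add' f g := by
    obtain ⟨S, hf, hg⟩ := 𝒥.exists_support₂ f g
    rw [𝒥.vertFun_eq_sum a hf, 𝒥.vertFun_eq_sum a hg, 𝒥.vertFun_eq_sum a (S := S),
      ← Finset.sum_add_distrib]
    · simp [mul_add]
    · intro s hs
      simp [hf s hs, hg s hs]
  map_smul' r f := by
    obtain ⟨S, hf⟩ := 𝒥.exists_support f
    rw [𝒥.vertFun_eq_sum a hf, 𝒥.vertFun_eq_sum a (S := S)]
    · simp [Finset.smul_sum]
    · intro s hs
      simp [hf s hs]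
  map_one_eq_zero' := by
    simp [vertFun]
  leibniz' f g := by
    obtain ⟨S, hf, hg⟩ := 𝒥.exists_support₂ f g
    change 𝒥.vertFun a (f * g) = f • 𝒥.vertFun a g + g • 𝒥.vertFun a f
    rw [𝒥.vertFun_eq_sum a hf, 𝒥.vertFun_eq_sum a hg, 𝒥.vertFun_eq_sum a (S := S),
      Finset.smul_sum, Finset.smul_sum, ← Finset.sum_add_distrib]
    · refine Finset.sum_congr rfl fun s _ => ?_
      simp only [Derivation.leibniz, smul_eq_mul]
      ring
    · intro s hs
      simp [hf s hs, hg s hs]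

theorem vert_eq_sum (a : Fin q × MultiIndex p → B) {f : B}
    {S : Finset (Fin q × MultiIndex p)} (hS : ∀ s ∉ S, 𝒥.dj s f = 0) :
    𝒥.vert a f = ∑ s ∈ S, a s * 𝒥.dj s f :=
  𝒥.vertFun_eq_sum a hS

theorem vert_u (a : Fin q × MultiIndex p → B) (s : Fin q × MultiIndex p) :
    𝒥.vert a (𝒥.u s) = a s := by
  classical
  rw [𝒥.vert_eq_sum a (S := {s})]
  · simp [dj_u]
  · intro r hr
    simp only [Finset.mem_singleton] at hr
    simp [dj_u, hr]

theorem vert_zero (f : B) : 𝒥.vert 0 f = 0 := by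
  obtain ⟨S, hS⟩ := 𝒥.exists_support f
  simp [𝒥.vert_eq_sum 0 hS]

/-- The commutator of two vector fields whose horizontal parts commute with everything. -/
theorem commutator (δ₁ δ₂ : Derivation ℝ B B) (h₁ : ∀ s f, δ₁ (𝒥.dj s f) = 𝒥.dj s (δ₁ f))
    (h₂ : ∀ s f, δ₂ (𝒥.dj s f) = 𝒥.dj s (δ₂ f)) (h₁₂ : ∀ f, δ₁ (δ₂ f) = δ₂ (δ₁ f))
    (a b : Fin q × MultiIndex p → B) (f : B) :
    (δ₁ + 𝒥.vert a) ((δ₂ + 𝒥.vert b) f) - (δ₂ + 𝒥.vert b) ((δ₁ + 𝒥.vert a) f) =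
      𝒥.vert (fun s => (δ₁ + 𝒥.vert a) (b s) - (δ₂ + 𝒥.vert b) (a s)) f := by
  obtain ⟨S, hS⟩ := 𝒥.exists_support f
  -- Expansion of one composite. All terms but the one differentiating the coefficients `b s` are
  -- symmetric under exchange of the two fields, up to `h₁₂` and the commutation of the `dj`, and
  -- cancel in the difference.
  have key : ∀ (δ₁ δ₂ : Derivation ℝ B B) (_ : ∀ s f, δ₁ (𝒥.dj s f) = 𝒥.dj s (δ₁ f))
      (_ : ∀ s f, δ₂ (𝒥.dj s f) = 𝒥.dj s (δ₂ f)) (a b : Fin q × MultiIndex p → B),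
      (δ₁ + 𝒥.vert a) ((δ₂ + 𝒥.vert b) f) = δ₁ (δ₂ f) + ∑ s ∈ S, a s * 𝒥.dj s (δ₂ f) +
        (∑ s ∈ S, (δ₁ + 𝒥.vert a) (b s) * 𝒥.dj s f) + (∑ s ∈ S, b s * 𝒥.dj s (δ₁ f)) +
        ∑ s ∈ S, ∑ r ∈ S, b s * (a r * 𝒥.dj r (𝒥.dj s f)) := by
    intro δ₁ δ₂ h₁ h₂ a b
    rw [Derivation.add_apply (D1 := δ₂), map_add, 𝒥.vert_eq_sum b hS, map_sum, add_assoc, add_assoc,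
      ← Finset.sum_add_distrib, ← Finset.sum_add_distrib]
    congr 1
    · rw [Derivation.add_apply, 𝒥.vert_eq_sum a (S := S)]
      intro s hs
      rw [← h₂, hS s hs, map_zero]
    · refine Finset.sum_congr rfl fun s _ => ?_
      have : (δ₁ + 𝒥.vert a) (𝒥.dj s f) =
          𝒥.dj s (δ₁ f) + ∑ r ∈ S, a r * 𝒥.dj r (𝒥.dj s f) := by
        rw [Derivation.add_apply, 𝒥.vert_eq_sum a (S := S), h₁]
        intro r hr
        rw [𝒥.dj_comm, hS r hr, map_zero]
      rw [Derivation.leibniz, this, ← Finset.mul_sum]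
      simp only [smul_eq_mul]
      ring
  rw [key δ₁ δ₂ h₁ h₂, key δ₂ δ₁ h₂ h₁, 𝒥.vert_eq_sum _ hS, h₁₂, Finset.sum_comm]
  have : ∑ y ∈ S, ∑ x ∈ S, b x * (a y * 𝒥.dj y (𝒥.dj x f)) =
      ∑ s ∈ S, ∑ r ∈ S, a s * (b r * 𝒥.dj r (𝒥.dj s f)) := by
    refine Finset.sum_congr rfl fun s _ => Finset.sum_congr rfl fun r _ => ?_
    rw [𝒥.dj_comm]
    ring
  rw [this]
  simp only [sub_mul, Finset.sum_sub_distrib]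
  ring

/-! ### Total derivatives -/

/-- The total derivative `D_i`. -/
def D (i : Fin p) : Derivation ℝ B B :=
  𝒥.d (.space i) + 𝒥.vert fun s => 𝒥.u (s.1, s.2 + Pi.single i 1)

theorem d_u {c : Coord p q} (h : ∀ s : Fin q × MultiIndex p, c ≠ .jet s.1 s.2) (hc : c ≠ .eps)
    (s : Fin q × MultiIndex p) : 𝒥.d c (𝒥.u s) = 0 := by
  rw [u, 𝒥.d_coord _ _ hc, if_neg (h s)]

theorem D_u (i : Fin p) (s : Fin q × MultiIndex p) :
    𝒥.D i (𝒥.u s) = 𝒥.u (s.1, s.2 + Pi.single i 1) := by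
  rw [D, Derivation.add_apply, 𝒥.vert_u, 𝒥.d_u (by simp) (by simp), zero_add]

theorem D_comm (i j : Fin p) (f : B) : 𝒥.D i (𝒥.D j f) = 𝒥.D j (𝒥.D i f) := by
  rw [← sub_eq_zero]
  refine (𝒥.commutator _ _ (𝒥.d_dj _) (𝒥.d_dj _) (𝒥.d_comm _ _) _ _ f).trans ?_
  convert 𝒥.vert_zero f
  rename_i s
  change 𝒥.D i (𝒥.u _) - 𝒥.D j (𝒥.u _) = 0
  rw [D_u, D_u]
  simp only [add_right_comm, sub_self]

/-- The iterated total derivative `D_J`. -/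
def DJ (J : MultiIndex p) : Module.End ℝ B :=
  ((List.finRange p).map fun i => ((𝒥.D i : B →ₗ[ℝ] B) : Module.End ℝ B) ^ J i).prod

theorem DJ_zero (f : B) : 𝒥.DJ 0 f = f := by
  have : ∀ l : List (Fin p),
      (l.map fun i => ((𝒥.D i : B →ₗ[ℝ] B) : Module.End ℝ B) ^ (0 : MultiIndex p) i).prod = 1 := by
    intro l
    induction l with
    | nil => rfl
    | cons j l ih => rw [List.map_cons, List.prod_cons, ih]; simp
  rw [DJ, this]; rfl

theorem DJ_commute {φ : Module.End ℝ B} (hφ : ∀ i f, φ (𝒥.D i f) = 𝒥.D i (φ f))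
    (J : MultiIndex p) (f : B) : φ (𝒥.DJ J f) = 𝒥.DJ J (φ f) := by
  have : Commute φ (𝒥.DJ J) := by
    apply Commute.list_prod_right
    intro x hx
    obtain ⟨i, -, rfl⟩ := List.mem_map.1 hx
    exact Commute.pow_right (LinearMap.ext fun f => hφ i f) _
  exact LinearMap.congr_fun this f

/-- The total derivatives commute, so the extra factor `D i` moves to the front of the ordered
product. -/
theorem DJ_succ (J : MultiIndex p) (i : Fin p) (f : B) :
    𝒥.DJ (J + Pi.single i 1) f = 𝒥.D i (𝒥.DJ J f) := by
  let E : Fin p → Module.End ℝ B := fun i => (𝒥.D i : B →ₗ[ℝ] B)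
  have hE : ∀ i j, Commute (E i) (E j) := fun i j => LinearMap.ext fun f => 𝒥.D_comm i j f
  have hnot : ∀ l : List (Fin p), i ∉ l →
      (l.map fun j => E j ^ (J + Pi.single i 1 : MultiIndex p) j) = l.map fun j => E j ^ J j := by
    intro l hl
    refine List.map_congr_left fun j hj => ?_
    have : j ≠ i := fun h => hl (h ▸ hj)
    simp [this]
  have key : ∀ l : List (Fin p), l.Nodup → i ∈ l →
      (l.map fun j => E j ^ (J + Pi.single i 1 : MultiIndex p) j).prod =
        E i * (l.map fun j => E j ^ J j).prod := by
    intro l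
    induction l with
    | nil => simp
    | cons j l ih =>
      intro hl hi
      rw [List.nodup_cons] at hl
      rw [List.map_cons, List.prod_cons, List.map_cons, List.prod_cons]
      by_cases h : j = i
      · subst h
        rw [hnot l hl.1, ← mul_assoc]
        simp [pow_succ']
      · rw [ih hl.2 ((List.mem_cons.1 hi).resolve_left (Ne.symm h)), ← mul_assoc, ← mul_assoc]
        congr 1
        simp only [Pi.add_apply, ne_eq, h, not_false_eq_true, Pi.single_eq_of_ne, add_zero]
        exact ((hE j i).pow_left _).eq
  exact LinearMap.congr_fun (key _ (List.nodup_finRange p) (List.mem_finRange i)) f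

/-! ### Evolutionary vector fields -/

/-- The prolonged evolutionary vector field. -/
def pr (Q : Fin q → B) : Derivation ℝ B B := 𝒥.vert fun s => 𝒥.DJ s.2 (Q s.1)

/-- The total time derivative on solutions of `u_t = K`. -/
def Dt (K : Fin q → B) : Derivation ℝ B B := 𝒥.d .time + 𝒥.pr K

/-- The commutator is vertical with coefficients `D_{J+i} Q - D_i D_J Q = 0`: prolongation is
defined precisely so that this holds. -/
theorem pr_D (Q : Fin q → B) (i : Fin p) (f : B) :
    𝒥.pr Q (𝒥.D i f) = 𝒥.D i (𝒥.pr Q f) := by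
  rw [← sub_eq_zero]
  have := 𝒥.commutator 0 (𝒥.d (.space i)) (by simp) (𝒥.d_dj _) (by simp)
    (fun s => 𝒥.DJ s.2 (Q s.1)) (fun s => 𝒥.u (s.1, s.2 + Pi.single i 1)) f
  rw [zero_add] at this
  refine this.trans ?_
  convert 𝒥.vert_zero f
  rename_i s
  change 𝒥.vert _ (𝒥.u _) - 𝒥.D i _ = 0
  rw [vert_u, DJ_succ, sub_self]

theorem Dt_D (K : Fin q → B) (i : Fin p) (f : B) :
    𝒥.Dt K (𝒥.D i f) = 𝒥.D i (𝒥.Dt K f) := by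
  have h : 𝒥.d .time (𝒥.D i f) = 𝒥.D i (𝒥.d .time f) := by
    rw [← sub_eq_zero]
    have := 𝒥.commutator (𝒥.d .time) (𝒥.d (.space i)) (𝒥.d_dj _) (𝒥.d_dj _) (𝒥.d_comm _ _)
      0 (fun s => 𝒥.u (s.1, s.2 + Pi.single i 1)) f
    have h0 : 𝒥.d .time + 𝒥.vert 0 = 𝒥.d .time := by
      ext g
      simp [vert_zero]
    rw [h0] at this
    refine this.trans ?_
    convert 𝒥.vert_zero f
    rename_i s
    change 𝒥.d .time (𝒥.u _) - 𝒥.D i 0 = 0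
    rw [𝒥.d_u (by simp) (by simp), map_zero, sub_self]
  rw [Dt, Derivation.add_apply, Derivation.add_apply, map_add, pr_D, h]

theorem d_time_D (i : Fin p) (f : B) : 𝒥.d .time (𝒥.D i f) = 𝒥.D i (𝒥.d .time f) := by
  have h := 𝒥.Dt_D 0 i f
  have h0 : 𝒥.Dt 0 = 𝒥.d .time := by
    ext g
    have : (fun s : Fin q × MultiIndex p => 𝒥.DJ s.2 ((0 : Fin q → B) s.1)) = 0 := by
      ext s; simp
    rw [Dt, pr, this, Derivation.add_apply, vert_zero, add_zero]
  rwa [h0] at h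

theorem pr_DJ (Q : Fin q → B) (J : MultiIndex p) (f : B) :
    𝒥.pr Q (𝒥.DJ J f) = 𝒥.DJ J (𝒥.pr Q f) :=
  𝒥.DJ_commute (φ := (𝒥.pr Q : B →ₗ[ℝ] B)) (𝒥.pr_D Q) J f

theorem d_time_DJ (J : MultiIndex p) (f : B) : 𝒥.d .time (𝒥.DJ J f) = 𝒥.DJ J (𝒥.d .time f) :=
  𝒥.DJ_commute (φ := (𝒥.d .time : B →ₗ[ℝ] B)) 𝒥.d_time_D J f

theorem pr_commutator (P Q : Fin q → B) (f : B) :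
    𝒥.pr P (𝒥.pr Q f) - 𝒥.pr Q (𝒥.pr P f) =
      𝒥.pr (fun α => 𝒥.pr P (Q α) - 𝒥.pr Q (P α)) f := by
  have := 𝒥.commutator 0 0 (by simp) (by simp) (by simp)
    (fun s => 𝒥.DJ s.2 (P s.1)) (fun s => 𝒥.DJ s.2 (Q s.1)) f
  simp only [zero_add] at this
  refine this.trans ?_
  rw [pr]
  congr 2
  ext s
  rw [map_sub, ← pr_DJ, ← pr_DJ]
  rfl

theorem pr_sub_char (P Q : Fin q → B) (f : B) :
    𝒥.pr (fun α => P α - Q α) f = 𝒥.pr P f - 𝒥.pr Q f := by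
  obtain ⟨S, hS⟩ := 𝒥.exists_support f
  simp only [pr, 𝒥.vert_eq_sum _ hS, map_sub, sub_mul, Finset.sum_sub_distrib]

/-! ### Divergences and the Euler operator -/

/-- The total divergence. -/
def div : (Fin p → B) →ₗ[ℝ] B := ∑ i, (𝒥.D i : B →ₗ[ℝ] B) ∘ₗ LinearMap.proj i

theorem div_apply (X : Fin p → B) : 𝒥.div X = ∑ i, 𝒥.D i (X i) := by
  simp [div]

/-- The space of total divergences. -/
def divRange : Submodule ℝ B := LinearMap.range 𝒥.div

theorem D_mem_divRange (i : Fin p) (f : B) : 𝒥.D i f ∈ 𝒥.divRange := by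
  refine ⟨Pi.single i f, ?_⟩
  rw [div_apply, Finset.sum_eq_single i]
  · simp
  · intro j _ hj
    simp [hj]
  · simp

theorem divRange_stable {φ : B →ₗ[ℝ] B} (hφ : ∀ i f, φ (𝒥.D i f) = 𝒥.D i (φ f)) {f : B}
    (hf : f ∈ 𝒥.divRange) : φ f ∈ 𝒥.divRange := by
  obtain ⟨X, rfl⟩ := hf
  rw [div_apply, map_sum]
  exact Submodule.sum_mem _ fun i _ => by rw [hφ]; exact 𝒥.D_mem_divRange _ _

/-- The summand of the Euler operator of multi-index `J`. -/
def eulerTerm (α : Fin q) (f : B) (J : MultiIndex p) : B :=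
  (-1 : B) ^ (∑ i, J i) * 𝒥.DJ J (𝒥.dj (α, J) f)

theorem neg_one_pow_mul (n : ℕ) {f : B} : (-1 : B) ^ n * f = ((-1 : ℝ) ^ n) • f := by
  rw [Algebra.smul_def]
  simp

theorem support_eulerTerm {α : Fin q} {f : B} {T : Finset (MultiIndex p)}
    (hT : ∀ J ∉ T, 𝒥.dj (α, J) f = 0) : Function.support (𝒥.eulerTerm α f) ⊆ T := by
  intro J hJ
  by_contra h
  exact hJ (by simp [eulerTerm, hT J h])

/-- The Euler operator. -/
def euler (f : B) (α : Fin q) : B := ∑ᶠ J, 𝒥.eulerTerm α f J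

theorem euler_eq_sum {α : Fin q} {f : B} {T : Finset (MultiIndex p)}
    (hT : ∀ J ∉ T, 𝒥.dj (α, J) f = 0) : 𝒥.euler f α = ∑ J ∈ T, 𝒥.eulerTerm α f J :=
  finsum_eq_sum_of_support_subset _ (𝒥.support_eulerTerm hT)

theorem finite_support_eulerTerm (α : Fin q) (f : B) :
    (Function.support (𝒥.eulerTerm α f)).Finite := by
  obtain ⟨T, hT⟩ := 𝒥.exists_jet_support f
  exact T.finite_toSet.subset (𝒥.support_eulerTerm (hT α))

theorem euler_add (f g : B) : 𝒥.euler (f + g) = 𝒥.euler f + 𝒥.euler g := by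
  ext α
  rw [Pi.add_apply, euler, euler, euler, ← finsum_add_distrib
    (𝒥.finite_support_eulerTerm α f) (𝒥.finite_support_eulerTerm α g)]
  simp [eulerTerm, mul_add]

/-- The Euler operator as an additive map. -/
def eulerHom : B →+ (Fin q → B) := AddMonoidHom.mk' 𝒥.euler 𝒥.euler_add

theorem d_time_euler (f : B) (α : Fin q) :
    𝒥.d .time (𝒥.euler f α) = 𝒥.euler (𝒥.d .time f) α := by
  obtain ⟨T, hT⟩ := 𝒥.exists_jet_support f
  rw [𝒥.euler_eq_sum (hT α), map_sum, 𝒥.euler_eq_sum (T := T)]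
  · refine Finset.sum_congr rfl fun J _ => ?_
    rw [eulerTerm, eulerTerm, neg_one_pow_mul, neg_one_pow_mul, Derivation.map_smul, d_time_DJ, d_dj]
  · intro J hJ
    rw [← d_dj, hT α J hJ, map_zero]

/-- The commutator of `∂/∂u_J` with `D_i` is `∂/∂u_{J-i}`, or zero if `J i = 0`. Indicator
coefficients avoid subtracting multi-indices. -/
theorem dj_D (s : Fin q × MultiIndex p) (i : Fin p) (f : B) :
    𝒥.dj s (𝒥.D i f) = 𝒥.D i (𝒥.dj s f) +
      𝒥.vert (fun r => if s = (r.1, r.2 + Pi.single i 1) then 1 else 0) f := by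
  have h0 : 𝒥.dj s + 𝒥.vert 0 = 𝒥.dj s := by
    ext g
    simp [vert_zero]
  have := 𝒥.commutator (𝒥.dj s) (𝒥.d (.space i)) (𝒥.dj_comm s) (𝒥.d_dj _)
    (fun f => (𝒥.d_dj _ _ _).symm) 0 (fun s => 𝒥.u (s.1, s.2 + Pi.single i 1)) f
  rw [h0] at this
  rw [← sub_eq_iff_eq_add']
  refine this.trans ?_
  congr 2
  ext r
  simp [dj_u]

theorem dj_succ_D (α : Fin q) (J : MultiIndex p) (i : Fin p) (f : B) :
    𝒥.dj (α, J + Pi.single i 1) (𝒥.D i f) =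
      𝒥.D i (𝒥.dj (α, J + Pi.single i 1) f) + 𝒥.dj (α, J) f := by
  classical
  rw [dj_D]
  congr 1
  obtain ⟨S, hS⟩ := 𝒥.exists_support f
  rw [𝒥.vert_eq_sum _ (S := insert (α, J) S) (fun s hs => hS s (by simp_all)),
    Finset.sum_eq_single (α, J)]
  · simp
  · rintro ⟨β, I⟩ _ h
    rw [if_neg, zero_mul]
    intro h'
    simp only [Prod.mk.injEq, add_left_inj] at h'
    exact h (by simp [h'])
  · simp

theorem dj_D_of_eq_zero (α : Fin q) {J : MultiIndex p} {i : Fin p} (hJ : J i = 0) (f : B) :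
    𝒥.dj (α, J) (𝒥.D i f) = 𝒥.D i (𝒥.dj (α, J) f) := by
  rw [dj_D, add_eq_left]
  convert 𝒥.vert_zero f using 3
  ext r
  rw [if_neg]
  · rfl
  · intro h
    simp only [Prod.mk.injEq] at h
    rw [h.2] at hJ
    simp at hJ

/-- The sum telescopes. Each term splits into `g J`, in which `D_i` is moved outside, and the
commutator part `h J`. The latter lives on multi-indices `J + i`, where it equals `-g J` because the
sign changes with the order. -/
theorem euler_D (i : Fin p) (f : B) : 𝒥.euler (𝒥.D i f) = 0 := by
  classical
  ext α
  set g : MultiIndex p → B := fun J => (-1 : B) ^ (∑ i, J i) * 𝒥.D i (𝒥.DJ J (𝒥.dj (α, J) f))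
    with hg
  set h : MultiIndex p → B := fun J => 𝒥.eulerTerm α (𝒥.D i f) J - g J with hh
  have hgf : (Function.support g).Finite := by
    obtain ⟨T, hT⟩ := 𝒥.exists_jet_support f
    refine T.finite_toSet.subset fun J hJ => ?_
    by_contra h
    exact hJ (by simp [hg, hT α J h])
  have hhf : (Function.support h).Finite :=
    ((𝒥.finite_support_eulerTerm α (𝒥.D i f)).union hgf).subset (Function.support_sub _ _)
  have hD : ∀ (J : MultiIndex p) (f : B), 𝒥.DJ J (𝒥.D i f) = 𝒥.D i (𝒥.DJ J f) := fun J f =>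
    (𝒥.DJ_commute (φ := (𝒥.D i : B →ₗ[ℝ] B)) (fun j f => 𝒥.D_comm i j f) J f).symm
  have h1 : ∀ J, h (J + Pi.single i 1) = - g J := by
    intro J
    simp only [hh, hg, eulerTerm, dj_succ_D, map_add, hD, DJ_succ, MultiIndex.sum_add_single,
      pow_succ]
    ring
  have h2 : ∀ J, J i = 0 → h J = 0 := by
    intro J hJ
    simp only [hh, hg, eulerTerm, 𝒥.dj_D_of_eq_zero α hJ, hD, sub_self]
  have h3 : ∑ᶠ J, h J = - ∑ᶠ J, g J := by
    have hinj : Function.Injective fun J : MultiIndex p => J + Pi.single i 1 :=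
      add_left_injective _
    rw [← finsum_neg_distrib]
    simp_rw [← h1]
    rw [← finsum_mem_range (f := h) hinj, finsum_mem_def]
    refine finsum_congr fun J => (Set.indicator_apply_eq_self.2 fun hJ => h2 J ?_).symm
    by_contra hJ'
    obtain ⟨J', rfl⟩ := MultiIndex.exists_eq_add_single hJ'
    exact hJ ⟨J', rfl⟩
  have h4 : 𝒥.eulerTerm α (𝒥.D i f) = fun J => g J + h J := by
    ext J
    simp [hh]
  rw [euler, h4, finsum_add_distrib hgf hhf, h3, add_neg_cancel, Pi.zero_apply]

theorem euler_divRange {f : B} (hf : f ∈ 𝒥.divRange) : 𝒥.euler f = 0 := by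
  obtain ⟨X, rfl⟩ := hf
  rw [div_apply]
  change 𝒥.eulerHom _ = 0
  rw [map_sum]
  exact Finset.sum_eq_zero fun i _ => 𝒥.euler_D i _

/-- One derivative at a time is moved from `f` to `g`; hence the induction must allow `g` to be
replaced by `D_i g`. -/
theorem DJ_mul_sub_mem (J : MultiIndex p) (f g : B) :
    𝒥.DJ J f * g - f * ((-1 : B) ^ (∑ i, J i) * 𝒥.DJ J g) ∈ 𝒥.divRange := by
  induction J using MultiIndex.induction generalizing g with
  | zero => simp [DJ_zero]
  | succ J i ih =>
    have h1 := 𝒥.D_mem_divRange i (𝒥.DJ J f * g)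
    have h2 := ih (𝒥.D i g)
    have h3 : 𝒥.DJ J (𝒥.D i g) = 𝒥.D i (𝒥.DJ J g) :=
      (𝒥.DJ_commute (φ := (𝒥.D i : B →ₗ[ℝ] B)) (fun j f => 𝒥.D_comm i j f) J g).symm
    convert Submodule.sub_mem _ h1 h2 using 1
    rw [DJ_succ, DJ_succ, MultiIndex.sum_add_single, h3, Derivation.leibniz, pow_succ]
    simp only [smul_eq_mul]
    ring

/-- Integration by parts. -/
theorem pr_sub_mem (Q : Fin q → B) (f : B) :
    𝒥.pr Q f - ∑ α, 𝒥.euler f α * Q α ∈ 𝒥.divRange := by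
  obtain ⟨T, hT⟩ := 𝒥.exists_jet_support f
  rw [pr, 𝒥.vert_eq_sum _ (S := Finset.univ ×ˢ T), Finset.sum_product, ← Finset.sum_sub_distrib]
  · refine Submodule.sum_mem _ fun α _ => ?_
    rw [𝒥.euler_eq_sum (hT α), Finset.sum_mul, ← Finset.sum_sub_distrib]
    refine Submodule.sum_mem _ fun J _ => ?_
    rw [mul_comm (𝒥.eulerTerm α f J)]
    exact 𝒥.DJ_mul_sub_mem J (Q α) _
  · rintro ⟨α, J⟩ h
    exact hT α J (by simpa using h)

/-! ### Nondegeneracy of the pairing with variational derivatives -/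

theorem D_coord_space (i j : Fin p) :
    𝒥.D j (𝒥.coord (.space i)) = if j = i then 1 else 0 := by
  obtain h : 𝒥.vert (fun s => 𝒥.u (s.1, s.2 + Pi.single j 1)) (𝒥.coord (.space i)) = 0 := by
    rw [𝒥.vert_eq_sum _ (S := ∅)]
    · simp
    · intro s _
      simp [dj, 𝒥.d_coord]
  rw [D, Derivation.add_apply, h, add_zero, 𝒥.d_coord _ _ (by simp)]
  simp

/-- In the Leibniz rule at most one derivative can fall on `x^i`. The truncated subtraction is
harmless, as its coefficient `J i` is zero whenever truncation occurs. -/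
theorem DJ_coord_mul (i : Fin p) (J : MultiIndex p) (g : B) :
    𝒥.DJ J (𝒥.coord (.space i) * g) =
      𝒥.coord (.space i) * 𝒥.DJ J g + (J i : B) * 𝒥.DJ (J - Pi.single i 1) g := by
  induction J using MultiIndex.induction with
  | zero => simp [DJ_zero]
  | succ J j ih =>
    have key : (if j = i then 𝒥.DJ J g else 0) + (J i : B) * 𝒥.D j (𝒥.DJ (J - Pi.single i 1) g) =
        ((J + Pi.single j 1 : MultiIndex p) i : B) *
          𝒥.DJ (J + Pi.single j 1 - Pi.single i 1) g := by
      by_cases hJ : J i = 0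
      · by_cases hj : j = i
        · subst hj
          simp [hJ]
        · simp [hJ, hj, Ne.symm hj]
      · obtain ⟨J', rfl⟩ := MultiIndex.exists_eq_add_single hJ
        rw [add_tsub_cancel_right, add_right_comm, add_tsub_cancel_right, DJ_succ]
        by_cases hj : j = i
        · subst hj
          simp only [if_true, Pi.add_apply, Pi.single_eq_same, DJ_succ]
          push_cast
          ring
        · simp [hj, Ne.symm hj, DJ_succ]
    rw [DJ_succ, ih, map_add, Derivation.leibniz, Derivation.leibniz, ← key, DJ_succ,
      D_coord_space]
    simp only [smul_eq_mul, Derivation.map_natCast]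
    split_ifs <;> ring

/-- The formal adjoint of `∑ a_J D_J`. -/
def adj (a : MultiIndex p → B) (f : B) : B :=
  ∑ᶠ J, (-1 : B) ^ (∑ i, J i) * 𝒥.DJ J (f * a J)

/-- The monomials in the independent variables. -/
def monomials : Submonoid B := Submonoid.closure (Set.range fun i => 𝒥.coord (.space i))

theorem dj_monomial {f : B} (hf : f ∈ 𝒥.monomials) (s : Fin q × MultiIndex p) :
    𝒥.dj s f = 0 := by
  induction hf using Submonoid.closure_induction with
  | mem x hx =>
    obtain ⟨i, rfl⟩ := hx
    simp [dj, 𝒥.d_coord]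
  | one => simp
  | mul x y _ _ hx hy => simp [hx, hy]

theorem finite_support_adj {a : MultiIndex p → B} (ha : (Function.support a).Finite) (f : B) :
    (Function.support fun J => (-1 : B) ^ (∑ i, J i) * 𝒥.DJ J (f * a J)).Finite := by
  refine ha.subset fun J hJ => ?_
  by_contra h
  rw [Function.notMem_support] at h
  exact hJ (by simp [h])

/-- Commuting a differential operator with multiplication by `x^i` lowers its order by one; this
drives the induction that recovers the coefficients from the action on monomials. -/
theorem adj_coord_mul {a : MultiIndex p → B} (ha : (Function.support a).Finite) (i : Fin p)
    (f : B) :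
    𝒥.adj (fun J => ((J i : B) + 1) * a (J + Pi.single i 1)) f =
      𝒥.coord (.space i) * 𝒥.adj a f - 𝒥.adj a (𝒥.coord (.space i) * f) := by
  have hinj : Function.Injective fun J : MultiIndex p => J + Pi.single i 1 :=
    add_left_injective _
  rw [adj, adj, adj, mul_finsum' _ _ (𝒥.finite_support_adj ha _),
    ← finsum_sub_distrib _ (𝒥.finite_support_adj ha _)]
  · set h : MultiIndex p → B := fun J =>
      𝒥.coord (.space i) * ((-1 : B) ^ (∑ i, J i) * 𝒥.DJ J (f * a J)) -
        (-1 : B) ^ (∑ i, J i) * 𝒥.DJ J (𝒥.coord (.space i) * f * a J) with hh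
    have h' : ∀ J, h J =
        - ((-1 : B) ^ (∑ i, J i) * ((J i : B) * 𝒥.DJ (J - Pi.single i 1) (f * a J))) := by
      intro J
      rw [hh]
      simp only [mul_assoc, DJ_coord_mul]
      ring
    have h1 : ∀ J : MultiIndex p, h (J + Pi.single i 1) =
        (-1 : B) ^ (∑ i, J i) * 𝒥.DJ J (f * (((J i : B) + 1) * a (J + Pi.single i 1))) := by
      intro J
      have hcast : f * (((J i : B) + 1) * a (J + Pi.single i 1)) =
          ((J i + 1 : ℕ) : ℝ) • (f * a (J + Pi.single i 1)) := by
        rw [Algebra.smul_def]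
        simp only [map_natCast]
        push_cast
        ring
      rw [h', hcast, map_smul, Algebra.smul_def, MultiIndex.sum_add_single,
        add_tsub_cancel_right, pow_succ]
      simp only [Pi.add_apply, Pi.single_eq_same, map_natCast]
      ring
    simp_rw [← h1]
    rw [← finsum_mem_range (f := h) hinj, finsum_mem_def]
    refine finsum_congr fun J => Set.indicator_apply_eq_self.2 fun hJ => ?_
    have : J i = 0 := by
      by_contra hJ'
      obtain ⟨J', rfl⟩ := MultiIndex.exists_eq_add_single hJ'
      exact hJ ⟨J', rfl⟩
    rw [h', this]
    simp
  · refine (𝒥.finite_support_adj ha f).subset fun J hJ => ?_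
    by_contra h
    rw [Function.notMem_support] at h
    exact hJ (by simp [h])

/-- An operator killing all monomials in `x` is zero: its commutators with the `x^i` also kill them
and have lower order, so all `a (J + i)` vanish by induction. The remaining coefficient `a 0` is the
value at the monomial `1`. -/
theorem eq_zero_of_adj_eq_zero (n : ℕ) {a : MultiIndex p → B}
    (ha : (Function.support a).Finite) (hn : ∀ J, a J ≠ 0 → ∑ i, J i ≤ n)
    (h : ∀ f ∈ 𝒥.monomials, 𝒥.adj a f = 0) : a = 0 := by
  have hsucc : ∀ (J : MultiIndex p) (i : Fin p), a (J + Pi.single i 1) = 0 := by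
    intro J i
    cases n with
    | zero =>
      by_contra h0
      have := hn _ h0
      rw [MultiIndex.sum_add_single] at this
      omega
    | succ n =>
      have := eq_zero_of_adj_eq_zero n
        (a := fun J => ((J i : B) + 1) * a (J + Pi.single i 1)) ?_ ?_ ?_
      · have h0 : ((J i + 1 : ℕ) : ℝ) • a (J + Pi.single i 1) = 0 := by
          rw [Algebra.smul_def]
          simpa using congrFun this J
        have h1 : ((J i + 1 : ℕ) : ℝ) ≠ 0 := by positivity
        exact (smul_eq_zero_iff_right h1).1 h0
      · refine (ha.preimage (f := fun J => J + Pi.single i 1)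
          (add_left_injective _).injOn).subset fun J hJ => ?_
        exact right_ne_zero_of_mul hJ
      · intro J hJ
        have := hn _ (right_ne_zero_of_mul hJ)
        rw [MultiIndex.sum_add_single] at this
        omega
      · intro f hf
        rw [𝒥.adj_coord_mul ha, h f hf,
          h _ (mul_mem (Submonoid.subset_closure ⟨i, rfl⟩) hf), mul_zero, sub_zero]
  have hne : ∀ J ≠ 0, a J = 0 := by
    intro J hJ
    obtain ⟨i, hi⟩ := Function.ne_iff.1 hJ
    obtain ⟨J', rfl⟩ := MultiIndex.exists_eq_add_single hi
    exact hsucc _ _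
  ext J
  by_cases hJ : J = 0
  · subst hJ
    have := h 1 (one_mem _)
    rw [adj, finsum_eq_single _ 0] at this
    · simpa [DJ_zero] using this
    · intro J hJ
      simp [hne J hJ]
  · exact hne J hJ

theorem euler_mul_u {g : B} (hg : ∀ s, 𝒥.dj s g = 0) (α β : Fin q) :
    𝒥.euler (g * 𝒥.u (α, 0)) β = if β = α then g else 0 := by
  rw [𝒥.euler_eq_sum (T := {0})]
  · simp [eulerTerm, DJ_zero, hg, dj_u]
  · intro J hJ
    simp only [Finset.mem_singleton] at hJ
    simp [hg, dj_u, hJ]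

theorem euler_u_mul_u (α β : Fin q) :
    𝒥.euler (𝒥.u (α, 0) * 𝒥.u (α, 0)) β = if β = α then 2 * 𝒥.u (α, 0) else 0 := by
  rw [𝒥.euler_eq_sum (T := {0})]
  · simp only [eulerTerm, Finset.sum_singleton, DJ_zero, Derivation.leibniz, dj_u, smul_eq_mul]
    by_cases h : β = α
    · simp [h, two_mul]
    · simp [h]
  · intro J hJ
    simp only [Finset.mem_singleton] at hJ
    simp [dj_u, hJ]

/-- Two kinds of test density suffice. With `R = f u^α`, `f` a monomial in `x`, the product `f A_α`
is a divergence; its Euler derivatives are the adjoint of the linearization of `A_α` applied to `f`,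
so `A_α` is free of jet variables. The Euler operator kills such functions, so linear densities
detect nothing more. With `R = (u^α)²` the divergence is `2 u^α A_α`, whose Euler derivative is `2
A_α`. -/
theorem eq_zero_of_pairing_mem {A : Fin q → B}
    (hA : ∀ R, ∑ α, 𝒥.euler R α * A α ∈ 𝒥.divRange) : A = 0 := by
  have hdj : ∀ α s, 𝒥.dj s (A α) = 0 := by
    rintro α ⟨β, J⟩
    obtain ⟨T, hT⟩ := 𝒥.exists_jet_support (A α)
    refine congrFun (𝒥.eq_zero_of_adj_eq_zero (T.sup fun J => ∑ i, J i)
      (a := fun J => 𝒥.dj (β, J) (A α)) ?_ ?_ ?_) J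
    · refine T.finite_toSet.subset fun J hJ => ?_
      by_contra h
      exact hJ (hT β J h)
    · intro J hJ
      refine Finset.le_sup (f := fun J : MultiIndex p => ∑ i, J i) ?_
      by_contra h
      exact hJ (hT β J h)
    · intro f hf
      have h := hA (f * 𝒥.u (α, 0))
      simp only [𝒥.euler_mul_u (𝒥.dj_monomial hf), ite_mul, zero_mul, Finset.sum_ite_eq',
        Finset.mem_univ, if_true] at h
      have h' := congrFun (𝒥.euler_divRange h) β
      rw [Pi.zero_apply] at h'
      rw [← h', euler, adj]
      refine finsum_congr fun J => ?_
      simp [eulerTerm, 𝒥.dj_monomial hf]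
  ext α
  have h := hA (𝒥.u (α, 0) * 𝒥.u (α, 0))
  simp only [euler_u_mul_u, ite_mul, zero_mul, Finset.sum_ite_eq', Finset.mem_univ,
    if_true] at h
  have h' := congrFun (𝒥.euler_divRange h) α
  have h2 : 2 * 𝒥.u (α, 0) * A α = (A α + A α) * 𝒥.u (α, 0) := by ring
  rw [h2, 𝒥.euler_mul_u (fun s => by simp [hdj]), if_pos rfl] at h'
  have h3 : (2 : ℝ) • A α = 0 := by
    rw [two_smul]
    exact h'
  exact (smul_eq_zero_iff_right two_ne_zero).1 h3

/-! ### Elements vanishing at the initial time -/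

theorem D_mem_initial (i : Fin p) {f : B} (hf : f ∈ 𝒥.initial) : 𝒥.D i f ∈ 𝒥.initial := by
  obtain ⟨S, hS⟩ := 𝒥.exists_support f
  rw [D, Derivation.add_apply, 𝒥.vert_eq_sum _ hS]
  refine add_mem (𝒥.d_mem_initial _ (by simp) _ hf) (sum_mem fun s _ => ?_)
  exact Ideal.mul_mem_left _ _ (𝒥.d_mem_initial _ (by simp) _ hf)

theorem DJ_mem_initial (J : MultiIndex p) {f : B} (hf : f ∈ 𝒥.initial) :
    𝒥.DJ J f ∈ 𝒥.initial := by
  induction J using MultiIndex.induction with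
  | zero => rwa [DJ_zero]
  | succ J i ih => rw [DJ_succ]; exact 𝒥.D_mem_initial i ih

theorem euler_mem_initial {f : B} (hf : f ∈ 𝒥.initial) (α : Fin q) :
    𝒥.euler f α ∈ 𝒥.initial := by
  obtain ⟨T, hT⟩ := 𝒥.exists_jet_support f
  rw [𝒥.euler_eq_sum (hT α)]
  exact sum_mem fun J _ => Ideal.mul_mem_left _ _
    (𝒥.DJ_mem_initial J (𝒥.d_mem_initial _ (by simp) _ hf))

/-! ### Hamiltonian operators and the Noether correspondence -/

/-- The bracket defined by an operator. -/
def bracket (𝒟 : (Fin q → B) →+ (Fin q → B)) (P L : B) : B :=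
  ∑ α, 𝒥.euler P α * 𝒟 (𝒥.euler L) α

variable (𝒟 : (Fin q → B) →+ (Fin q → B))

/-- Modulo divergences, brackets may be exchanged for derivatives along Hamiltonian fields. -/
theorem pr_sub_bracket_mem (P L : B) :
    𝒥.pr (𝒟 (𝒥.euler L)) P - 𝒥.bracket 𝒟 P L ∈ 𝒥.divRange :=
  𝒥.pr_sub_mem _ _

theorem pr_mem_divRange (Q : Fin q → B) {f : B} (hf : f ∈ 𝒥.divRange) :
    𝒥.pr Q f ∈ 𝒥.divRange :=
  𝒥.divRange_stable (φ := (𝒥.pr Q : B →ₗ[ℝ] B)) (𝒥.pr_D Q) hf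

theorem Dt_mem_divRange (Q : Fin q → B) {f : B} (hf : f ∈ 𝒥.divRange) :
    𝒥.Dt Q f ∈ 𝒥.divRange :=
  𝒥.divRange_stable (φ := (𝒥.Dt Q : B →ₗ[ℝ] B)) (𝒥.Dt_D Q) hf

variable {𝒟}

/-- The Hamiltonian vector fields represent the bracket. -/
theorem hamiltonian_commutator
    (hskew : ∀ P L, 𝒥.bracket 𝒟 P L + 𝒥.bracket 𝒟 L P ∈ 𝒥.divRange)
    (hjac : ∀ P L R, 𝒥.bracket 𝒟 (𝒥.bracket 𝒟 P L) R + 𝒥.bracket 𝒟 (𝒥.bracket 𝒟 L R) P +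
      𝒥.bracket 𝒟 (𝒥.bracket 𝒟 R P) L ∈ 𝒥.divRange) (P H : B) (ν : Fin q) :
    𝒥.pr (𝒟 (𝒥.euler H)) (𝒟 (𝒥.euler P) ν) - 𝒥.pr (𝒟 (𝒥.euler P)) (𝒟 (𝒥.euler H) ν) =
      𝒟 (𝒥.euler (𝒥.bracket 𝒟 P H)) ν := by
  set QP := 𝒟 (𝒥.euler P) with hQP
  set QH := 𝒟 (𝒥.euler H) with hQH
  set W := 𝒟 (𝒥.euler (𝒥.bracket 𝒟 P H)) with hW
  rw [← sub_eq_zero]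
  refine congrFun (𝒥.eq_zero_of_pairing_mem
    (A := fun ν => 𝒥.pr QH (QP ν) - 𝒥.pr QP (QH ν) - W ν) fun R => ?_) ν
  -- Modulo divergences the pairing with `δR` is `{{R,P},H} - {{R,H},P} - {R,{P,H}}`, which
  -- skew-symmetry turns into the Jacobi sum of `P, H, R`. Replacements inside the first slot of a
  -- bracket are made through `pr`, which preserves divergences.
  have e1 := 𝒥.pr_sub_mem (fun ν => 𝒥.pr QH (QP ν) - 𝒥.pr QP (QH ν) - W ν) R
  rw [pr_sub_char, ← pr_commutator] at e1
  have e2 := 𝒥.pr_sub_bracket_mem 𝒟 R (𝒥.bracket 𝒟 P H)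
  have e3 := hskew (𝒥.bracket 𝒟 P H) R
  have e4 := hjac P H R
  have e5 := 𝒥.pr_sub_bracket_mem 𝒟 (𝒥.bracket 𝒟 R P) H
  have e6 := 𝒥.pr_mem_divRange QH (𝒥.pr_sub_bracket_mem 𝒟 R P)
  have e7 := 𝒥.pr_sub_bracket_mem 𝒟 (𝒥.bracket 𝒟 H R) P
  have e8 := 𝒥.pr_mem_divRange QP (hskew H R)
  have e9 := 𝒥.pr_mem_divRange QP (𝒥.pr_sub_bracket_mem 𝒟 R H)
  rw [← hQP] at e6 e7
  rw [← hQH] at e5 e9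
  rw [← hW] at e2
  rw [map_sub] at e6 e9
  rw [map_add] at e8
  rw [← Submodule.Quotient.mk_eq_zero] at e1 e2 e3 e4 e5 e6 e7 e8 e9 ⊢
  simp only [Submodule.Quotient.mk_sub, Submodule.Quotient.mk_add] at e1 e2 e3 e4 e5 e6 e7 e8 e9
  linear_combination (norm := module) -e1 - e2 - e3 + e4 + e5 + e6 + e7 - e8 - e9

/-- Noether's correspondence in a jet algebra. -/
theorem noether
    (hskew : ∀ P L, 𝒥.bracket 𝒟 P L + 𝒥.bracket 𝒟 L P ∈ 𝒥.divRange)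
    (hjac : ∀ P L R, 𝒥.bracket 𝒟 (𝒥.bracket 𝒟 P L) R + 𝒥.bracket 𝒟 (𝒥.bracket 𝒟 L R) P +
      𝒥.bracket 𝒟 (𝒥.bracket 𝒟 R P) L ∈ 𝒥.divRange)
    (htime : ∀ Q α, 𝒥.d .time (𝒟 Q α) = 𝒟 (fun β => 𝒥.d .time (Q β)) α)
    (hinit : ∀ Q, (∀ β, Q β ∈ 𝒥.initial) → ∀ α, 𝒟 Q α ∈ 𝒥.initial) (H P : B) :
    (∀ ν, 𝒥.Dt (𝒟 (𝒥.euler H)) (𝒟 (𝒥.euler P) ν) -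
        𝒥.pr (𝒟 (𝒥.euler P)) (𝒟 (𝒥.euler H) ν) = 0) ↔
      ∃ G P', (∀ α, 𝒟 (𝒥.euler G) α = 0) ∧ P' - (P - G) ∈ 𝒥.divRange ∧
        𝒥.Dt (𝒟 (𝒥.euler H)) P' ∈ 𝒥.divRange := by
  have hte : ∀ (F : B) (ν : Fin q),
      𝒥.d .time (𝒟 (𝒥.euler F) ν) = 𝒟 (𝒥.euler (𝒥.d .time F)) ν := by
    intro F ν
    rw [htime]
    exact congrArg (fun X => 𝒟 X ν) (funext fun β => 𝒥.d_time_euler F β)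
  -- A distinguished functional is constant along the flow up to its explicit time dependence: `{G,
  -- H} ≡ -{H, G} = 0`.
  have hdist : ∀ G, (∀ α, 𝒟 (𝒥.euler G) α = 0) →
      𝒥.pr (𝒟 (𝒥.euler H)) G ∈ 𝒥.divRange := by
    intro G hG
    have h1 := 𝒥.pr_sub_bracket_mem 𝒟 G H
    have h2 := hskew G H
    have h3 : 𝒥.bracket 𝒟 H G = 0 := by simp [bracket, hG]
    rw [h3, add_zero] at h2
    simpa using add_mem h1 h2
  -- The symmetry defect is itself a Hamiltonian characteristic, that of `∂_t P + {P, H}`.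
  have hsym : ∀ ν, 𝒥.Dt (𝒟 (𝒥.euler H)) (𝒟 (𝒥.euler P) ν) -
      𝒥.pr (𝒟 (𝒥.euler P)) (𝒟 (𝒥.euler H) ν) =
        𝒟 (𝒥.euler (𝒥.d .time P + 𝒥.bracket 𝒟 P H)) ν := by
    intro ν
    rw [Dt, Derivation.add_apply, add_sub_assoc, 𝒥.hamiltonian_commutator hskew hjac, hte,
      euler_add, map_add, Pi.add_apply]
  simp only [hsym]
  constructor
  · intro hL
    -- `G` must absorb the distinguished functional by which `P` fails to be conserved, so its time
    -- derivative is prescribed. The initial condition fixes the constant of integration so that `𝒟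
    -- δG` vanishes.
    obtain ⟨G, hG, hGt⟩ := 𝒥.exists_primitive (𝒥.d .time P + 𝒥.bracket 𝒟 P H)
    have hG0 : ∀ α, 𝒟 (𝒥.euler G) α = 0 := by
      intro α
      refine 𝒥.eq_zero_of_mem_initial _ (hinit _ (𝒥.euler_mem_initial hG) α) ?_
      rw [hte, hGt, hL]
    refine ⟨G, P - G, hG0, by simp, ?_⟩
    have h1 := 𝒥.pr_sub_bracket_mem 𝒟 P H
    have h2 := hdist G hG0
    convert sub_mem h1 h2 using 1
    rw [map_sub, Dt, Derivation.add_apply, Derivation.add_apply, hGt]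
    ring
  · rintro ⟨G, P', hG, hPG, hP'⟩ ν
    have h1 : 𝒥.d .time P + 𝒥.bracket 𝒟 P H - 𝒥.d .time G ∈ 𝒥.divRange := by
      have h2 := 𝒥.Dt_mem_divRange (𝒟 (𝒥.euler H)) hPG
      have h3 := hdist G hG
      have h4 := 𝒥.pr_sub_bracket_mem 𝒟 P H
      convert add_mem (sub_mem (sub_mem hP' h2) h4) h3 using 1
      simp only [map_sub]
      simp only [Dt, Derivation.add_apply]
      ring
    have h5 : 𝒥.euler (𝒥.d .time P + 𝒥.bracket 𝒟 P H) = 𝒥.euler (𝒥.d .time G) := by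
      have h6 := 𝒥.euler_divRange h1
      have h7 : 𝒥.eulerHom (𝒥.d .time P + 𝒥.bracket 𝒟 P H - 𝒥.d .time G) = 0 := h6
      rw [map_sub, sub_eq_zero] at h7
      exact h7
    rw [h5, ← hte, hG, map_zero]

end JetAlgebra

/-! ### Smoothness of parametric integrals -/

/-- Compactness of `[0, 1]` times a closed ball gives the constant dominating function needed to
pass limits and derivatives under the integral. -/
theorem exists_bound_of_continuousOn {E F : Type*} [NormedAddCommGroup E] [ProperSpace E]
    [NormedAddCommGroup F] {h : ℝ × E → F} {W : Set (ℝ × E)} {V : Set E} (hV : IsOpen V)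
    (hVW : ∀ s ∈ Set.Icc (0 : ℝ) 1, ∀ y ∈ V, (s, y) ∈ W) (hh : ContinuousOn h W) {y₀ : E}
    (hy : y₀ ∈ V) :
    ∃ C, ∃ N ∈ 𝓝 y₀, N ⊆ V ∧ ∀ s ∈ Set.Icc (0 : ℝ) 1, ∀ y ∈ N, ‖h (s, y)‖ ≤ C := by
  obtain ⟨r, hr, hrV⟩ := Metric.nhds_basis_closedBall.mem_iff.1 (hV.mem_nhds hy)
  have hK : IsCompact (Set.Icc (0 : ℝ) 1 ×ˢ Metric.closedBall y₀ r) :=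
    isCompact_Icc.prod (isCompact_closedBall _ _)
  obtain ⟨C, hC⟩ := hK.exists_bound_of_continuousOn
    (hh.mono fun x hx => hVW _ hx.1 _ (hrV hx.2))
  exact ⟨C, _, Metric.closedBall_mem_nhds y₀ hr, hrV, fun s hs y hy => hC _ ⟨hs, hy⟩⟩

theorem continuousOn_slice {E F : Type*} [TopologicalSpace E] [TopologicalSpace F]
    {h : ℝ × E → F} {W : Set (ℝ × E)} {V : Set E}
    (hVW : ∀ s ∈ Set.Icc (0 : ℝ) 1, ∀ y ∈ V, (s, y) ∈ W) (hh : ContinuousOn h W) {y : E}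
    (hy : y ∈ V) : ContinuousOn (fun s => h (s, y)) (Set.Icc 0 1) :=
  hh.comp (by fun_prop) fun s hs => hVW s hs y hy

theorem uIoc_zero_one_subset : Set.uIoc (0 : ℝ) 1 ⊆ Set.Icc 0 1 := by
  rw [Set.uIoc_of_le zero_le_one]
  exact Set.Ioc_subset_Icc_self

theorem continuousOn_integral {E F : Type*} [NormedAddCommGroup E] [ProperSpace E]
    [NormedAddCommGroup F] [NormedSpace ℝ F] {h : ℝ × E → F} {W : Set (ℝ × E)} {V : Set E}
    (hV : IsOpen V) (hW : IsOpen W) (hVW : ∀ s ∈ Set.Icc (0 : ℝ) 1, ∀ y ∈ V, (s, y) ∈ W)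
    (hh : ContinuousOn h W) : ContinuousOn (fun y => ∫ s in (0 : ℝ)..1, h (s, y)) V := by
  intro y₀ hy₀
  obtain ⟨C, N, hN, hNV, hC⟩ := exists_bound_of_continuousOn hV hVW hh hy₀
  apply ContinuousAt.continuousWithinAt
  refine intervalIntegral.continuousAt_of_dominated_interval (bound := fun _ => C) ?_ ?_
    intervalIntegrable_const ?_
  · filter_upwards [hN] with y hy
    exact ((continuousOn_slice hVW hh (hNV hy)).mono
      uIoc_zero_one_subset).aestronglyMeasurable measurableSet_uIoc
  · filter_upwards [hN] with y hy
    exact Filter.Eventually.of_forall fun s hs => hC s (uIoc_zero_one_subset hs) y hy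
  · refine Filter.Eventually.of_forall fun s hs => ?_
    have : ContinuousAt h (s, y₀) :=
      hh.continuousAt (hW.mem_nhds (hVW s (uIoc_zero_one_subset hs) y₀ hy₀))
    exact ContinuousAt.comp (f := fun y => (s, y)) this (by fun_prop)

/-- The derivative of the integral is the integral of the partial derivative in `y`, which has
values in `E →L[ℝ] F`; so the target space has to vary in the induction. -/
theorem contDiffOn_integral_nat {E : Type} [NormedAddCommGroup E] [NormedSpace ℝ E]
    [ProperSpace E] {W : Set (ℝ × E)} {V : Set E} (hV : IsOpen V) (hW : IsOpen W)
    (hVW : ∀ s ∈ Set.Icc (0 : ℝ) 1, ∀ y ∈ V, (s, y) ∈ W) (n : ℕ) {F : Type}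
    [NormedAddCommGroup F] [NormedSpace ℝ F] {h : ℝ × E → F} (hh : ContDiffOn ℝ n h W) :
    ContDiffOn ℝ n (fun y => ∫ s in (0 : ℝ)..1, h (s, y)) V := by
  induction n generalizing F with
  | zero =>
    simp only [Nat.cast_zero, contDiffOn_zero] at hh ⊢
    exact continuousOn_integral hV hW hVW hh
  | succ n ih =>
    set h' : ℝ × E → E →L[ℝ] F := fun x => (fderiv ℝ h x).comp (ContinuousLinearMap.inr ℝ ℝ E)
      with hh'
    have hd : ContDiffOn ℝ n (fderiv ℝ h) W := hh.fderiv_of_isOpen hW (by norm_cast)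
    have hc : ContDiffOn ℝ n h' W := hd.clm_comp contDiffOn_const
    have hder : ∀ y ∈ V, HasFDerivAt (fun y => ∫ s in (0 : ℝ)..1, h (s, y))
        (∫ s in (0 : ℝ)..1, h' (s, y)) y := by
      intro y₀ hy₀
      obtain ⟨C, N, hN, hNV, hC⟩ := exists_bound_of_continuousOn hV hVW hc.continuousOn hy₀
      refine intervalIntegral.hasFDerivAt_integral_of_dominated_of_fderiv_le
        (F := fun y s => h (s, y)) (F' := fun y s => h' (s, y)) (bound := fun _ => C) hN
        ?_ ?_ ?_ ?_ intervalIntegrable_const ?_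
      · filter_upwards [hN] with y hy
        exact ((continuousOn_slice hVW hh.continuousOn (hNV hy)).mono
          uIoc_zero_one_subset).aestronglyMeasurable measurableSet_uIoc
      · refine ContinuousOn.intervalIntegrable ?_
        rw [Set.uIcc_of_le zero_le_one]
        exact continuousOn_slice hVW hh.continuousOn hy₀
      · exact ((continuousOn_slice hVW hc.continuousOn hy₀).mono
          uIoc_zero_one_subset).aestronglyMeasurable measurableSet_uIoc
      · exact Filter.Eventually.of_forall fun s hs y hy => hC s (uIoc_zero_one_subset hs) y hy
      · refine Filter.Eventually.of_forall fun s hs y hy => ?_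
        have hx : (s, y) ∈ W := hVW s (uIoc_zero_one_subset hs) y (hNV hy)
        have h1 : HasFDerivAt h (fderiv ℝ h (s, y)) (s, y) :=
          ((hh.differentiableOn (by simp)).differentiableAt (hW.mem_nhds hx)).hasFDerivAt
        exact h1.comp y (hasFDerivAt_prodMk_right s y)
    push_cast
    rw [contDiffOn_succ_iff_fderiv_of_isOpen hV]
    refine ⟨fun y hy => (hder y hy).differentiableAt.differentiableWithinAt, by simp, ?_⟩
    exact (ih hc).congr fun y hy => (hder y hy).fderiv

theorem contDiffOn_integral {E : Type} [NormedAddCommGroup E] [NormedSpace ℝ E]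
    [ProperSpace E] {W : Set (ℝ × E)} {V : Set E} (hV : IsOpen V) (hW : IsOpen W)
    (hVW : ∀ s ∈ Set.Icc (0 : ℝ) 1, ∀ y ∈ V, (s, y) ∈ W) {F : Type}
    [NormedAddCommGroup F] [NormedSpace ℝ F] {h : ℝ × E → F} (hh : ContDiffOn ℝ ∞ h W) :
    ContDiffOn ℝ ∞ (fun y => ∫ s in (0 : ℝ)..1, h (s, y)) V :=
  contDiffOn_infty.2 fun n => contDiffOn_integral_nat hV hW hVW n (contDiffOn_infty.1 hh n)

/-! ### Taylor coefficients and orders of vanishing -/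

theorem isLittleO_pow_iff {g : ℝ → ℝ} (hg : ContDiffAt ℝ ∞ g 0) (k : ℕ) :
    (g =o[𝓝 0] fun ε : ℝ => ε ^ k) ↔ ∀ j ≤ k, iteratedDeriv j g 0 = 0 := by
  have taylor : ∀ n : ℕ, (fun x => g x - ∑ i ∈ Finset.range (n + 1),
      (i.factorial : ℝ)⁻¹ * x ^ i * iteratedDeriv i g 0) =o[𝓝 0] fun x : ℝ => x ^ n := by
    intro n
    obtain ⟨u, hu, hgu⟩ := (hg.of_le (m := n) (by exact_mod_cast le_top)).contDiffOn le_rfl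
      (by simp)
    obtain ⟨r, hr, hru⟩ := Metric.mem_nhds_iff.1 hu
    have h0 : (0 : ℝ) ∈ Metric.ball (0 : ℝ) r := Metric.mem_ball_self hr
    have := taylor_isLittleO (convex_ball (0 : ℝ) r) h0 (hgu.mono hru)
    rw [nhdsWithin_eq_nhds.2 (Metric.isOpen_ball.mem_nhds h0)] at this
    simp only [taylor_within_apply, sub_zero, smul_eq_mul] at this
    refine this.congr_left fun x => ?_
    congr 1
    refine Finset.sum_congr rfl fun i _ => ?_
    rw [iteratedDerivWithin_of_isOpen Metric.isOpen_ball h0]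
  constructor
  · intro h j
    induction j using Nat.strong_induction_on with
    -- Once the lower coefficients vanish, the Taylor polynomial of degree `j` is a single multiple
    -- of `ε^j`, and this can be `o(ε^j)` only if the coefficient is zero.
    | _ j ih =>
      intro hjk
      have h1 : g =o[𝓝 0] fun x : ℝ => x ^ j :=
        h.trans_isBigO <| hjk.eq_or_lt.elim (fun h => h ▸ Asymptotics.isBigO_refl _ _)
          fun h => (Asymptotics.isLittleO_pow_pow h).isBigO
      have h2 := h1.sub (taylor j)
      have h3 : (fun x : ℝ => (j.factorial : ℝ)⁻¹ * iteratedDeriv j g 0 * x ^ j) =o[𝓝 0]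
          fun x : ℝ => x ^ j := by
        refine h2.congr_left fun x => ?_
        rw [Finset.sum_range_succ, Finset.sum_eq_zero fun i hi => ?_]
        · ring
        · rw [ih i (Finset.mem_range.1 hi) ((Finset.mem_range.1 hi).le.trans hjk), mul_zero]
      by_contra hne
      have hc : (j.factorial : ℝ)⁻¹ * iteratedDeriv j g 0 ≠ 0 :=
        mul_ne_zero (inv_ne_zero (by positivity)) hne
      have h4 : (fun x : ℝ => x ^ j) =o[𝓝 0] fun x : ℝ => x ^ j :=
        (Asymptotics.isLittleO_const_mul_left_iff hc).1 h3
      have h5 := (Asymptotics.isLittleO_irrefl' (l := 𝓝 (0:ℝ)) (f' := fun x : ℝ => x ^ j) ?_) h4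
      · exact h5
      · have : ∃ᶠ x : ℝ in 𝓝[≠] 0, ‖x ^ j‖ ≠ 0 := by
          apply Filter.Eventually.frequently
          filter_upwards [self_mem_nhdsWithin] with x hx
          exact norm_ne_zero_iff.2 (pow_ne_zero _ hx)
        exact this.filter_mono nhdsWithin_le_nhds
  · intro h
    refine (taylor k).congr_left fun x => ?_
    rw [Finset.sum_eq_zero fun i hi => ?_, sub_zero]
    rw [h i (Nat.lt_succ_iff.1 (Finset.mem_range.1 hi)), mul_zero]

section differentialFunctions

variable {p q : ℕ} {Ω : Domain p q}

/-! ### The domain -/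

theorem Domain.isOpen_carrier (Ω : Domain p q) : IsOpen Ω.carrier := by
  have h1 : IsOpen {z : JetPoint p q | z .time ∈ Ω.T} := Ω.isOpen_T.preimage (continuous_apply _)
  have h2 : IsOpen {z : JetPoint p q |
      ((fun i => z (.space i), fun α => z (.jet α 0)) : (Fin p → ℝ) × (Fin q → ℝ)) ∈ Ω.M} :=
    Ω.isOpen_M.preimage (by fun_prop)
  have h3 : IsOpen {z : JetPoint p q | |z .eps| < Ω.eps0} :=
    isOpen_lt (by fun_prop) continuous_const
  exact h1.inter (h2.inter h3)

theorem continuous_update (z : JetPoint p q) (c : Coord p q) :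
    Continuous fun s : ℝ => Function.update z c s :=
  continuous_const.update c continuous_id

theorem Domain.eventually_update_mem (Ω : Domain p q) {z : JetPoint p q} (hz : z ∈ Ω.carrier)
    (c : Coord p q) : ∀ᶠ s in 𝓝 (z c), Function.update z c s ∈ Ω.carrier := by
  refine (continuous_update z c).continuousAt.eventually_mem (Ω.isOpen_carrier.mem_nhds ?_)
  rwa [Function.update_eq_self]

theorem Domain.update_time_mem (Ω : Domain p q) {z : JetPoint p q} (hz : z ∈ Ω.carrier) {t : ℝ}
    (ht : t ∈ Ω.T) : Function.update z .time t ∈ Ω.carrier := by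
  refine ⟨by simpa using ht, ?_, by simpa using hz.2.2⟩
  simpa using hz.2.1

theorem Domain.update_eps_mem (Ω : Domain p q) {z : JetPoint p q} (hz : z ∈ Ω.carrier) {ε : ℝ}
    (hε : |ε| < Ω.eps0) : Function.update z .eps ε ∈ Ω.carrier := by
  refine ⟨by simpa using hz.1, ?_, by simpa using hε⟩
  simpa using hz.2.1

theorem Domain.eventually_update_eps_mem (Ω : Domain p q) {z : JetPoint p q}
    (hz : z ∈ Ω.carrier) : ∀ᶠ ε in 𝓝 (0 : ℝ), Function.update z .eps ε ∈ Ω.carrier := by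
  filter_upwards [Metric.ball_mem_nhds (0 : ℝ) Ω.eps0_pos] with ε hε
  exact Ω.update_eps_mem hz (by simpa using hε)

theorem Domain.ordConnected_T (Ω : Domain p q) : Ω.T.OrdConnected :=
  Ω.isConnected_T.isPreconnected.ordConnected

/-! ### Charts of differential functions -/

/-- The projection to finitely many coordinates. -/
def proj (S : Finset (Coord p q)) (z : JetPoint p q) : S → ℝ := fun c => z c

theorem proj_update_of_mem {S : Finset (Coord p q)} {c : Coord p q} (hc : c ∈ S)
    (z : JetPoint p q) (s : ℝ) :
    proj S (Function.update z c s) = Function.update (proj S z) ⟨c, hc⟩ s := by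
  ext e
  by_cases h : e = ⟨c, hc⟩
  · subst h
    simp [proj]
  · have : (e : Coord p q) ≠ c := fun h' => h (Subtype.ext h')
    simp [proj, h, this]

theorem proj_update_of_notMem {S : Finset (Coord p q)} {c : Coord p q} (hc : c ∉ S)
    (z : JetPoint p q) (s : ℝ) : proj S (Function.update z c s) = proj S z := by
  ext e
  have : (e : Coord p q) ≠ c := fun h' => hc (h' ▸ e.2)
  simp [proj, this]

/-- Points near a projection are lifted by filling in the missing coordinates from the base point,
which depends continuously on them. -/
theorem isOpen_proj (Ω : Domain p q) (S : Finset (Coord p q)) :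
    IsOpen (proj S '' Ω.carrier) := by
  rw [isOpen_iff_mem_nhds]
  rintro _ ⟨z, hz, rfl⟩
  let glue : (S → ℝ) → JetPoint p q := fun y c => if h : c ∈ S then y ⟨c, h⟩ else z c
  have hglue : Continuous glue := by
    refine continuous_pi fun c => ?_
    by_cases h : c ∈ S
    · simpa only [glue, dif_pos h] using continuous_apply _
    · simpa only [glue, dif_neg h] using continuous_const
  have hz' : glue (proj S z) = z := by
    ext c
    by_cases h : c ∈ S <;> simp [glue, proj, h]
  filter_upwards [hglue.continuousAt.eventually_mem
    (Ω.isOpen_carrier.mem_nhds (by rwa [hz']))] with y hy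
  refine ⟨_, hy, ?_⟩
  ext c
  simp [glue, proj]

/-- `f` represents `F` smoothly in terms of the coordinates in `S`. -/
def IsChart (Ω : Domain p q) (S : Finset (Coord p q)) (f : (S → ℝ) → ℝ) (F : JetFun p q) : Prop :=
  ContDiffOn ℝ ∞ f (proj S '' Ω.carrier) ∧ ∀ z ∈ Ω.carrier, F z = f (proj S z)

theorem IsChart.mono {S S' : Finset (Coord p q)} {f : (S → ℝ) → ℝ} {F : JetFun p q}
    (h : IsChart Ω S f F) (hS : S ⊆ S') :
    IsChart Ω S' (fun y => f fun c => y ⟨c, hS c.2⟩) F := by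
  refine ⟨h.1.comp (g := f) (f := fun (y : S' → ℝ) (c : S) => y ⟨c, hS c.2⟩) (by fun_prop) ?_,
    fun z hz => h.2 z hz⟩
  rintro _ ⟨z, hz, rfl⟩
  exact ⟨z, hz, rfl⟩

theorem IsDiffFun.exists_chart {F : JetFun p q} (h : IsDiffFun Ω F) (S : Finset (Coord p q)) :
    ∃ S' f, S ⊆ S' ∧ IsChart Ω S' f F := by
  obtain ⟨T, f, hf⟩ := h
  exact ⟨S ∪ T, _, Finset.subset_union_left, IsChart.mono hf Finset.subset_union_right⟩

theorem IsDiffFun.exists_chart₂ {F G : JetFun p q} (hF : IsDiffFun Ω F) (hG : IsDiffFun Ω G) :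
    ∃ S f g, IsChart Ω S f F ∧ IsChart Ω S g G := by
  obtain ⟨T, f, hf⟩ := hF
  obtain ⟨S, g, hS, hg⟩ := hG.exists_chart T
  exact ⟨S, _, g, IsChart.mono hf hS, hg⟩

theorem IsDiffFun.congr {F G : JetFun p q} (hF : IsDiffFun Ω F)
    (h : ∀ z ∈ Ω.carrier, G z = F z) : IsDiffFun Ω G := by
  obtain ⟨S, f, hf⟩ := hF
  exact ⟨S, f, hf.1, fun z hz => (h z hz).trans (hf.2 z hz)⟩

theorem IsDiffFun.const (r : ℝ) : IsDiffFun Ω fun _ => r :=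
  ⟨∅, fun _ => r, contDiffOn_const, fun _ _ => rfl⟩

theorem IsDiffFun.coord (c : Coord p q) : IsDiffFun Ω fun z => z c :=
  ⟨{c}, fun y => y ⟨c, by simp⟩, by fun_prop, fun _ _ => rfl⟩

theorem IsDiffFun.add {F G : JetFun p q} (hF : IsDiffFun Ω F) (hG : IsDiffFun Ω G) :
    IsDiffFun Ω (F + G) := by
  obtain ⟨S, f, g, hf, hg⟩ := hF.exists_chart₂ hG
  exact ⟨S, fun y => f y + g y, hf.1.add hg.1, fun z hz => congrArg₂ _ (hf.2 z hz) (hg.2 z hz)⟩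

theorem IsDiffFun.mul {F G : JetFun p q} (hF : IsDiffFun Ω F) (hG : IsDiffFun Ω G) :
    IsDiffFun Ω (F * G) := by
  obtain ⟨S, f, g, hf, hg⟩ := hF.exists_chart₂ hG
  exact ⟨S, fun y => f y * g y, hf.1.mul hg.1, fun z hz => congrArg₂ _ (hf.2 z hz) (hg.2 z hz)⟩

/-! ### Partial derivatives -/

theorem IsChart.hasDerivAt_of_mem {S : Finset (Coord p q)} {f : (S → ℝ) → ℝ} {F : JetFun p q}
    (h : IsChart Ω S f F) {c : Coord p q} (hc : c ∈ S) {z : JetPoint p q} (hz : z ∈ Ω.carrier) :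
    HasDerivAt (fun s => F (Function.update z c s))
      (fderiv ℝ f (proj S z) (Pi.single ⟨c, hc⟩ 1)) (z c) := by
  have h1 : HasFDerivAt f (fderiv ℝ f (proj S z))
      (Function.update (proj S z) ⟨c, hc⟩ (z c)) := by
    have : Function.update (proj S z) ⟨c, hc⟩ (z c) = proj S z :=
      Function.update_eq_self (⟨c, hc⟩ : S) (proj S z)
    rw [this]
    exact ((h.1.differentiableOn (by simp)).differentiableAt
      ((isOpen_proj Ω S).mem_nhds ⟨z, hz, rfl⟩)).hasFDerivAt
  have h2 := h1.comp_hasDerivAt _ (hasDerivAt_update (proj S z) ⟨c, hc⟩ (z c))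
  refine h2.congr_of_eventuallyEq ?_
  filter_upwards [Ω.eventually_update_mem hz c] with s hs
  rw [h.2 _ hs, proj_update_of_mem hc]
  rfl

theorem IsChart.hasDerivAt_of_notMem {S : Finset (Coord p q)} {f : (S → ℝ) → ℝ}
    {F : JetFun p q} (h : IsChart Ω S f F) {c : Coord p q} (hc : c ∉ S) {z : JetPoint p q}
    (hz : z ∈ Ω.carrier) : HasDerivAt (fun s => F (Function.update z c s)) 0 (z c) := by
  refine (hasDerivAt_const (z c) (F z)).congr_of_eventuallyEq ?_
  filter_upwards [Ω.eventually_update_mem hz c] with s hs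
  rw [h.2 _ hs, proj_update_of_notMem hc, h.2 _ hz]

theorem IsDiffFun.hasDerivAt {F : JetFun p q} (h : IsDiffFun Ω F) (c : Coord p q)
    {z : JetPoint p q} (hz : z ∈ Ω.carrier) :
    HasDerivAt (fun s => F (Function.update z c s)) (pd c F z) (z c) := by
  obtain ⟨S, f, hS, hf⟩ := h.exists_chart {c}
  exact (hf.hasDerivAt_of_mem (by simpa using hS) hz).differentiableAt.hasDerivAt

theorem IsDiffFun.hasDerivAt_update {F : JetFun p q} (h : IsDiffFun Ω F) (c : Coord p q)
    {z : JetPoint p q} {s : ℝ} (hz : Function.update z c s ∈ Ω.carrier) :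
    HasDerivAt (fun s => F (Function.update z c s)) (pd c F (Function.update z c s)) s := by
  simpa using h.hasDerivAt c hz

theorem IsChart.pd {S : Finset (Coord p q)} {f : (S → ℝ) → ℝ} {F : JetFun p q}
    (h : IsChart Ω S f F) {c : Coord p q} (hc : c ∈ S) :
    IsChart Ω S (fun y => fderiv ℝ f y (Pi.single ⟨c, hc⟩ 1)) (pd c F) :=
  ⟨(h.1.fderiv_of_isOpen (isOpen_proj Ω S) (by simp)).clm_apply contDiffOn_const,
    fun _ hz => (h.hasDerivAt_of_mem hc hz).deriv⟩

theorem IsDiffFun.pd {F : JetFun p q} (h : IsDiffFun Ω F) (c : Coord p q) :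
    IsDiffFun Ω (pd c F) := by
  obtain ⟨S, f, hS, hf⟩ := h.exists_chart {c}
  exact ⟨S, _, hf.pd (by simpa using hS)⟩

theorem IsDiffFun.pd_iterate {F : JetFun p q} (h : IsDiffFun Ω F) (c : Coord p q) (n : ℕ) :
    IsDiffFun Ω ((PerturbedHamiltonian.pd c)^[n] F) := by
  induction n with
  | zero => exact h
  | succ n ih => rw [Function.iterate_succ_apply']; exact ih.pd c

theorem pd_congr {F G : JetFun p q} (h : ∀ z ∈ Ω.carrier, F z = G z) (c : Coord p q) :
    ∀ z ∈ Ω.carrier, pd c F z = pd c G z := by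
  intro z hz
  apply Filter.EventuallyEq.deriv_eq
  filter_upwards [Ω.eventually_update_mem hz c] with s hs using h _ hs

theorem IsDiffFun.finite_support {F : JetFun p q} (h : IsDiffFun Ω F) :
    ∃ S : Finset (Coord p q), ∀ c ∉ S, ∀ z ∈ Ω.carrier, PerturbedHamiltonian.pd c F z = 0 := by
  obtain ⟨S, f, hf⟩ := h
  exact ⟨S, fun c hc z hz => (IsChart.hasDerivAt_of_notMem hf hc hz).deriv⟩

theorem pd_add {F G : JetFun p q} (hF : IsDiffFun Ω F) (hG : IsDiffFun Ω G) (c : Coord p q)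
    {z : JetPoint p q} (hz : z ∈ Ω.carrier) : pd c (F + G) z = pd c F z + pd c G z :=
  ((hF.hasDerivAt c hz).add (hG.hasDerivAt c hz)).deriv

theorem pd_mul {F G : JetFun p q} (hF : IsDiffFun Ω F) (hG : IsDiffFun Ω G) (c : Coord p q)
    {z : JetPoint p q} (hz : z ∈ Ω.carrier) :
    pd c (F * G) z = F z * pd c G z + G z * pd c F z := by
  have := ((hF.hasDerivAt c hz).mul (hG.hasDerivAt c hz)).deriv
  simp only [Function.update_eq_self] at this
  refine this.trans ?_
  ring

theorem pd_const (c : Coord p q) (r : ℝ) (z : JetPoint p q) : pd c (fun _ => r) z = 0 :=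
  deriv_const _ _

theorem pd_coord (c e : Coord p q) (z : JetPoint p q) :
    pd c (fun z => z e) z = if c = e then 1 else 0 := by
  by_cases h : c = e
  · subst h
    simp [pd]
  · simp [pd, h, Ne.symm h]

theorem pd_comm {F : JetFun p q} (hF : IsDiffFun Ω F) (c e : Coord p q) {z : JetPoint p q}
    (hz : z ∈ Ω.carrier) : pd c (pd e F) z = pd e (pd c F) z := by
  obtain ⟨S, f, hS, hf⟩ := hF.exists_chart {c, e}
  have hc : c ∈ S := hS (by simp)
  have he : e ∈ S := hS (by simp)
  have hmem := (isOpen_proj Ω S).mem_nhds ⟨z, hz, rfl⟩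
  have hd : DifferentiableAt ℝ (fderiv ℝ f) (proj S z) :=
    ((hf.1.fderiv_of_isOpen (m := ∞) (isOpen_proj Ω S) (by simp)).differentiableOn
      (by simp)).differentiableAt hmem
  have key : ∀ {c e : Coord p q} (hc : c ∈ S) (he : e ∈ S), pd c (pd e F) z =
      fderiv ℝ (fderiv ℝ f) (proj S z) (Pi.single ⟨c, hc⟩ 1) (Pi.single ⟨e, he⟩ 1) := by
    intro c e hc he
    rw [((hf.pd he).pd hc).2 z hz]
    change fderiv ℝ (fun y => fderiv ℝ f y (Pi.single ⟨e, he⟩ 1)) (proj S z) _ = _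
    rw [fderiv_clm_apply hd (differentiableAt_const _)]
    simp
  rw [key hc he, key he hc]
  exact (hf.1.contDiffAt hmem).isSymmSndFDerivAt (by simp; exact WithTop.coe_le_coe.2 le_top) _ _

theorem pd_eps_iterate_comm {F : JetFun p q} (hF : IsDiffFun Ω F) (c : Coord p q) (n : ℕ) :
    ∀ z ∈ Ω.carrier, (pd .eps)^[n] (pd c F) z = pd c ((pd .eps)^[n] F) z := by
  induction n with
  | zero => intro z _; rfl
  | succ n ih =>
    intro z hz
    rw [Function.iterate_succ_apply', Function.iterate_succ_apply',
      pd_congr ih .eps z hz, pd_comm (hF.pd_iterate _ n) _ _ hz]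

/-- The derivative along a slice of a function that vanishes on the slice. -/
theorem pd_eq_zero_of_slice {F : JetFun p q} {c e : Coord p q} (hce : c ≠ e) {r : ℝ}
    (h : ∀ z ∈ Ω.carrier, z e = r → F z = 0) {z : JetPoint p q} (hz : z ∈ Ω.carrier)
    (hr : z e = r) : pd c F z = 0 := by
  have : (fun s => F (Function.update z c s)) =ᶠ[𝓝 (z c)] fun _ => 0 := by
    filter_upwards [Ω.eventually_update_mem hz c] with s hs
    exact h _ hs (by rw [Function.update_of_ne hce.symm, hr])
  rw [pd, this.deriv_eq, deriv_const]

/-! ### Approximate equality -/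

theorem IsDiffFun.contDiffAt_eps {F : JetFun p q} (hF : IsDiffFun Ω F) {z : JetPoint p q}
    (hz : z ∈ Ω.carrier) : ContDiffAt ℝ ∞ (fun ε => F (Function.update z .eps ε)) 0 := by
  obtain ⟨S, f, hS, hf⟩ := hF.exists_chart {.eps}
  have hc : Coord.eps ∈ S := by simpa using hS
  have h0 : Function.update z .eps 0 ∈ Ω.carrier :=
    Ω.update_eps_mem hz (by simpa using Ω.eps0_pos)
  have h1 : ContDiffAt ℝ ∞ f (Function.update (proj S z) ⟨.eps, hc⟩ 0) := by
    rw [← proj_update_of_mem hc]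
    exact hf.1.contDiffAt ((isOpen_proj Ω S).mem_nhds ⟨_, h0, rfl⟩)
  refine (h1.comp (0 : ℝ) (contDiff_update _ _ _).contDiffAt).congr_of_eventuallyEq ?_
  filter_upwards [Ω.eventually_update_eps_mem hz] with ε hε
  rw [hf.2 _ hε, proj_update_of_mem hc]
  rfl

theorem iteratedDeriv_eps (F : JetFun p q) (z : JetPoint p q) (n : ℕ) (ε : ℝ) :
    iteratedDeriv n (fun ε => F (Function.update z .eps ε)) ε =
      (pd .eps)^[n] F (Function.update z .eps ε) := by
  induction n generalizing ε with
  | zero => rfl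
  | succ n ih =>
    rw [iteratedDeriv_succ, Function.iterate_succ_apply', funext ih]
    simp [pd]

/-- An asymptotic condition, which cannot in general be differentiated, becomes the vanishing of
finitely many functions on the slice `ε = 0`, which can be differentiated along the slice. -/
theorem isLittleO_iff {F : JetFun p q} (hF : IsDiffFun Ω F) (k : ℕ) :
    IsLittleO Ω k F ↔ ∀ j ≤ k, ∀ z ∈ Ω.carrier, z .eps = 0 → (pd .eps)^[j] F z = 0 := by
  constructor
  · intro h j hj z hz h0
    have := (isLittleO_pow_iff (hF.contDiffAt_eps hz) k).1 (h z hz) j hj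
    rwa [iteratedDeriv_eps, Function.update_eq_self_iff.2 h0.symm] at this
  · intro h z hz
    refine (isLittleO_pow_iff (hF.contDiffAt_eps hz) k).2 fun j hj => ?_
    rw [iteratedDeriv_eps]
    exact h j hj _ (Ω.update_eps_mem hz (by simpa using Ω.eps0_pos)) (by simp)

theorem IsLittleO.add {k : ℕ} {F G : JetFun p q} (hF : IsLittleO Ω k F) (hG : IsLittleO Ω k G) :
    IsLittleO Ω k (F + G) :=
  fun z hz => (hF z hz).add (hG z hz)

theorem IsLittleO.mul_left {k : ℕ} {F G : JetFun p q} (hG : IsDiffFun Ω G)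
    (hF : IsLittleO Ω k F) : IsLittleO Ω k (G * F) := by
  intro z hz
  have h1 := (hG.contDiffAt_eps hz).continuousAt.tendsto.isBigO_one ℝ
  simpa using h1.mul_isLittleO (hF z hz)

theorem isLittleO_of_eq_zero {k : ℕ} {F : JetFun p q} (hF : ∀ z ∈ Ω.carrier, F z = 0) :
    IsLittleO Ω k F := by
  intro z hz
  refine (Asymptotics.isLittleO_zero _ _).congr' ?_ Filter.EventuallyEq.rfl
  filter_upwards [Ω.eventually_update_eps_mem hz] with ε hε using (hF _ hε).symm

/-- This makes the derivative well defined on classes. The exclusion of `ε` is essential: `ε^(k+1)`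
is `o(ε^k)`, while its `ε`-derivative is not. -/
theorem IsLittleO.pd {k : ℕ} {F : JetFun p q} (hF : IsDiffFun Ω F) (h : IsLittleO Ω k F)
    {c : Coord p q} (hc : c ≠ .eps) : IsLittleO Ω k (pd c F) := by
  rw [isLittleO_iff (hF.pd c)]
  rw [isLittleO_iff hF] at h
  intro j hj z hz h0
  rw [pd_eps_iterate_comm hF c j z hz]
  exact pd_eq_zero_of_slice hc (h j hj) hz h0

/-- A function is of lower order if its time derivative is and if it vanishes initially. -/
theorem isLittleO_of_pd_time {k : ℕ} {F : JetFun p q} (hF : IsDiffFun Ω F) {t₀ : ℝ}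
    (ht₀ : t₀ ∈ Ω.T) (h0 : ∀ z ∈ Ω.carrier, z .time = t₀ → F z = 0)
    (h : IsLittleO Ω k (PerturbedHamiltonian.pd .time F)) : IsLittleO Ω k F := by
  rw [isLittleO_iff (hF.pd _)] at h
  rw [isLittleO_iff hF]
  intro j hj z hz hε
  -- At `t₀` the function vanishes for every `ε`, hence so do all its `ε`-derivatives there. On the
  -- slice `ε = 0`, those of order at most `k` are constant in time, as `Ω.T` is connected.
  have hinit : ∀ j, ∀ z ∈ Ω.carrier, z .time = t₀ →
      (PerturbedHamiltonian.pd .eps)^[j] F z = 0 := by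
    intro j
    induction j with
    | zero => exact h0
    | succ j ih =>
      intro z hz ht
      rw [Function.iterate_succ_apply']
      exact pd_eq_zero_of_slice (by simp) ih hz ht
  have hd : ∀ t ∈ Ω.T, HasDerivAt
      (fun t => (PerturbedHamiltonian.pd .eps)^[j] F (Function.update z .time t)) 0 t := by
    intro t ht
    have hm := Ω.update_time_mem hz ht
    have := (hF.pd_iterate .eps j).hasDerivAt_update .time hm
    rwa [← pd_eps_iterate_comm hF _ _ _ hm, h j hj _ hm (by simpa using hε)] at this
  have := Ω.isOpen_T.is_const_of_deriv_eq_zero Ω.isConnected_T.isPreconnected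
    (fun t ht => (hd t ht).differentiableAt.differentiableWithinAt)
    (fun t ht => (hd t ht).deriv) hz.1 ht₀
  simp only [Function.update_eq_self] at this
  rw [this]
  exact hinit j _ (Ω.update_time_mem hz ht₀) (by simp)

/-! ### Primitives in time -/

/-- The primitive in time that vanishes at the time `t₀`. -/
def primitive (t₀ : ℝ) (F : JetFun p q) : JetFun p q :=
  fun z => ∫ θ in t₀..z .time, F (Function.update z .time θ)

/-- The substitution `θ = t₀ + (t - t₀) s` moves the variable endpoint into the integrand, leaving a
parametric integral over `[0, 1]`; convexity of the time interval keeps the segment inside the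
domain. -/
theorem IsDiffFun.primitive {F : JetFun p q} (hF : IsDiffFun Ω F) {t₀ : ℝ} (ht₀ : t₀ ∈ Ω.T) :
    IsDiffFun Ω (primitive t₀ F) := by
  obtain ⟨S, f, hS, hf⟩ := hF.exists_chart {.time}
  have hc : Coord.time ∈ S := by simpa using hS
  set τ : S := ⟨.time, hc⟩ with hτ
  set V : Set (S → ℝ) := proj S '' Ω.carrier with hV
  let φ : ℝ × (S → ℝ) → (S → ℝ) := fun x => Function.update x.2 τ (t₀ + (x.2 τ - t₀) * x.1)
  have hφ : ContDiff ℝ ∞ φ := by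
    refine contDiff_pi.2 fun e => ?_
    by_cases h : e = τ
    · subst h
      simp only [φ, Function.update_self]
      fun_prop
    · simp only [φ, Function.update_of_ne h]
      fun_prop
  have hseg : ∀ z ∈ Ω.carrier, ∀ s ∈ Set.Icc (0 : ℝ) 1, t₀ + (z .time - t₀) * s ∈ Ω.T := by
    intro z hz s hs
    have := Ω.ordConnected_T.convex.add_smul_sub_mem ht₀ hz.1 hs
    simpa [mul_comm] using this
  have hφz : ∀ z s, φ (s, proj S z) =
      proj S (Function.update z .time (t₀ + (z .time - t₀) * s)) := by
    intro z s
    rw [proj_update_of_mem hc]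
    rfl
  have hVW : ∀ s ∈ Set.Icc (0 : ℝ) 1, ∀ y ∈ V, (s, y) ∈ φ ⁻¹' V := by
    rintro s hs _ ⟨z, hz, rfl⟩
    rw [Set.mem_preimage, hφz]
    exact ⟨_, Ω.update_time_mem hz (hseg z hz s hs), rfl⟩
  have hg := contDiffOn_integral (isOpen_proj Ω S)
    ((isOpen_proj Ω S).preimage hφ.continuous) hVW (h := fun x => f (φ x))
    (hf.1.comp hφ.contDiffOn fun x hx => hx)
  refine ⟨S, fun y => (y τ - t₀) * ∫ s in (0 : ℝ)..1, f (φ (s, y)),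
    ContDiffOn.mul (by fun_prop) hg, fun z hz => ?_⟩
  have hsub := intervalIntegral.mul_integral_comp_add_mul (a := 0) (b := 1)
    (f := fun θ => F (Function.update z .time θ)) (z .time - t₀) t₀
  have hend : t₀ + (z .time - t₀) * 1 = z .time := by ring
  rw [mul_zero, add_zero, hend] at hsub
  rw [PerturbedHamiltonian.primitive, ← hsub]
  congr 1
  refine intervalIntegral.integral_congr fun s hs => ?_
  rw [Set.uIcc_of_le zero_le_one] at hs
  change F _ = f (φ (s, proj S z))
  rw [hφz, hf.2 _ (Ω.update_time_mem hz (hseg z hz s hs))]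

theorem pd_time_primitive {F : JetFun p q} (hF : IsDiffFun Ω F) {t₀ : ℝ} (ht₀ : t₀ ∈ Ω.T)
    {z : JetPoint p q} (hz : z ∈ Ω.carrier) : pd .time (primitive t₀ F) z = F z := by
  have hcont : ContinuousOn (fun θ => F (Function.update z .time θ)) Ω.T := fun t ht =>
    (hF.hasDerivAt_update .time (Ω.update_time_mem hz ht)).continuousAt.continuousWithinAt
  have h := intervalIntegral.integral_hasDerivAt_right (a := t₀) (b := z .time)
    (f := fun θ => F (Function.update z .time θ))
    (hcont.mono (Ω.ordConnected_T.uIcc_subset ht₀ hz.1)).intervalIntegrable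
    (hcont.stronglyMeasurableAtFilter Ω.isOpen_T _ hz.1)
    (hcont.continuousAt (Ω.isOpen_T.mem_nhds hz.1))
  rw [Function.update_eq_self] at h
  rw [← h.deriv, pd]
  simp [primitive]

theorem primitive_eq_zero (t₀ : ℝ) (F : JetFun p q) {z : JetPoint p q} (hz : z .time = t₀) :
    primitive t₀ F z = 0 := by
  rw [primitive, hz, intervalIntegral.integral_same]

end differentialFunctions

section approxAlgebra

variable {p q : ℕ} {Ω : Domain p q} {k : ℕ}

/-! ### The algebra of differential functions up to approximate equality -/

/-- The algebra of differential functions. -/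
def diffAlgebra (Ω : Domain p q) : Subalgebra ℝ (JetFun p q) where
  carrier := {F | IsDiffFun Ω F}
  mul_mem' := IsDiffFun.mul
  add_mem' := IsDiffFun.add
  algebraMap_mem' r := IsDiffFun.const r

/-- The ideal of differential functions that are `o(ε^k)`. -/
def littleOIdeal (Ω : Domain p q) (k : ℕ) : Ideal (diffAlgebra Ω) where
  carrier := {F | IsLittleO Ω k F}
  zero_mem' := isLittleO_of_eq_zero fun _ _ => rfl
  add_mem' := IsLittleO.add
  smul_mem' G _ hF := IsLittleO.mul_left G.2 hF

/-- Differential functions up to `o(ε^k)`. -/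
def ApproxAlgebra (Ω : Domain p q) (k : ℕ) : Type := diffAlgebra Ω ⧸ littleOIdeal Ω k

instance : CommRing (ApproxAlgebra Ω k) :=
  inferInstanceAs (CommRing (diffAlgebra Ω ⧸ littleOIdeal Ω k))

instance : Algebra ℝ (ApproxAlgebra Ω k) :=
  inferInstanceAs (Algebra ℝ (diffAlgebra Ω ⧸ littleOIdeal Ω k))

/-- The projection of differential functions to their classes. -/
def toApprox (Ω : Domain p q) (k : ℕ) : diffAlgebra Ω →ₐ[ℝ] ApproxAlgebra Ω k :=
  Ideal.Quotient.mkₐ ℝ (littleOIdeal Ω k)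

/-- `F` is a differential function of class `b`. -/
def Rep (Ω : Domain p q) (k : ℕ) (F : JetFun p q) (b : ApproxAlgebra Ω k) : Prop :=
  ∃ h : IsDiffFun Ω F, toApprox Ω k ⟨F, h⟩ = b

theorem IsDiffFun.exists_rep (k : ℕ) {F : JetFun p q} (h : IsDiffFun Ω F) : ∃ b, Rep Ω k F b :=
  ⟨_, h, rfl⟩

theorem exists_rep (b : ApproxAlgebra Ω k) : ∃ F, Rep Ω k F b := by
  obtain ⟨⟨F, h⟩, rfl⟩ := Ideal.Quotient.mk_surjective b
  exact ⟨F, h, rfl⟩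

namespace Rep

variable {F G : JetFun p q} {b c : ApproxAlgebra Ω k}

theorem add (hF : Rep Ω k F b) (hG : Rep Ω k G c) : Rep Ω k (fun z => F z + G z) (b + c) := by
  obtain ⟨hF, rfl⟩ := hF
  obtain ⟨hG, rfl⟩ := hG
  exact ⟨hF.add hG, map_add (toApprox Ω k) ⟨F, hF⟩ ⟨G, hG⟩⟩

theorem mul (hF : Rep Ω k F b) (hG : Rep Ω k G c) : Rep Ω k (fun z => F z * G z) (b * c) := by
  obtain ⟨hF, rfl⟩ := hF
  obtain ⟨hG, rfl⟩ := hG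
  exact ⟨hF.mul hG, map_mul (toApprox Ω k) ⟨F, hF⟩ ⟨G, hG⟩⟩

theorem const (r : ℝ) : Rep Ω k (fun _ => r) (algebraMap ℝ _ r) :=
  ⟨IsDiffFun.const r, rfl⟩

theorem one : Rep Ω k (fun _ => 1) 1 :=
  ⟨IsDiffFun.const 1, rfl⟩

theorem zero : Rep Ω k (fun _ => 0) 0 :=
  ⟨IsDiffFun.const 0, rfl⟩

theorem neg (hF : Rep Ω k F b) : Rep Ω k (fun z => -F z) (-b) := by
  obtain ⟨hF, rfl⟩ := hF
  exact ⟨(diffAlgebra Ω).neg_mem hF, map_neg (toApprox Ω k) ⟨F, hF⟩⟩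

theorem sub (hF : Rep Ω k F b) (hG : Rep Ω k G c) : Rep Ω k (fun z => F z - G z) (b - c) := by
  simpa only [sub_eq_add_neg] using hF.add hG.neg

theorem sum {ι : Type*} (S : Finset ι) {F : ι → JetFun p q} {b : ι → ApproxAlgebra Ω k}
    (h : ∀ i ∈ S, Rep Ω k (F i) (b i)) : Rep Ω k (fun z => ∑ i ∈ S, F i z) (∑ i ∈ S, b i) := by
  classical
  induction S using Finset.induction_on with
  | empty => simpa using zero
  | insert i S hi ih =>
    simp only [Finset.sum_insert hi]
    exact (h i (by simp)).add (ih fun j hj => h j (by simp [hj]))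

theorem eq_zero_iff (hF : Rep Ω k F b) : b = 0 ↔ IsLittleO Ω k F := by
  obtain ⟨hF, rfl⟩ := hF
  exact Ideal.Quotient.eq_zero_iff_mem

theorem eq_of_eq (hF : Rep Ω k F b) (hG : Rep Ω k G c) (h : ∀ z ∈ Ω.carrier, F z = G z) :
    b = c := by
  rw [← sub_eq_zero, (hF.sub hG).eq_zero_iff]
  exact isLittleO_of_eq_zero fun z hz => sub_eq_zero.2 (h z hz)

theorem congr (hF : Rep Ω k F b) (h : ∀ z ∈ Ω.carrier, G z = F z) : Rep Ω k G b := by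
  obtain ⟨c, hc⟩ := (hF.1.congr h).exists_rep k
  rwa [← hc.eq_of_eq hF h]

theorem pd_eq {e : Coord p q} (he : e ≠ .eps) {b' c' : ApproxAlgebra Ω k} (hF : Rep Ω k F b)
    (hG : Rep Ω k G b) (hF' : Rep Ω k (pd e F) b') (hG' : Rep Ω k (pd e G) c') : b' = c' := by
  have h1 : IsLittleO Ω k fun z => F z - G z := (hF.sub hG).eq_zero_iff.1 (sub_self b)
  rw [← sub_eq_zero, (hF'.sub hG').eq_zero_iff]
  refine (((hF.sub hG).1.pd e).exists_rep k).elim fun c hc => ?_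
  have h2 := hc.eq_zero_iff.2 (h1.pd (hF.sub hG).1 he)
  refine (hc.congr fun z hz => ?_).eq_zero_iff.1 h2
  exact (((hF.1.hasDerivAt e hz).sub (hG.1.hasDerivAt e hz)).deriv).symm

end Rep

/-- The class of a differential function, and zero for other functions. -/
def approxClass (Ω : Domain p q) (k : ℕ) (F : JetFun p q) : ApproxAlgebra Ω k :=
  open Classical in if h : IsDiffFun Ω F then toApprox Ω k ⟨F, h⟩ else 0

theorem IsDiffFun.rep_approxClass (k : ℕ) {F : JetFun p q} (h : IsDiffFun Ω F) :
    Rep Ω k F (approxClass Ω k F) :=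
  ⟨h, by simp [approxClass, h]⟩

/-- A differential function representing a class. -/
def representative (b : ApproxAlgebra Ω k) : JetFun p q := (exists_rep b).choose

theorem rep_representative (b : ApproxAlgebra Ω k) : Rep Ω k (representative b) b :=
  (exists_rep b).choose_spec

/-- Partial derivatives of classes of differential functions. -/
def pdFun (e : Coord p q) (b : ApproxAlgebra Ω k) : ApproxAlgebra Ω k :=
  if e = .eps then 0 else approxClass Ω k (pd e (representative b))

theorem Rep.pdFun {F : JetFun p q} {b : ApproxAlgebra Ω k} {e : Coord p q} (he : e ≠ .eps)
    (hF : Rep Ω k F b) : Rep Ω k (pd e F) (pdFun e b) := by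
  obtain ⟨c, hc⟩ := (hF.1.pd e).exists_rep k
  have h := ((rep_representative b).1.pd e).rep_approxClass k
  rw [PerturbedHamiltonian.pdFun, if_neg he, ← hF.pd_eq he (rep_representative b) hc h]
  exact hc

/-- Partial derivatives as derivations. -/
def pdDerivation (Ω : Domain p q) (k : ℕ) (e : Coord p q) :
    Derivation ℝ (ApproxAlgebra Ω k) (ApproxAlgebra Ω k) :=
  if he : e = .eps then 0 else
  Derivation.mk'
    { toFun := pdFun e
      map_add' := fun b c => by
        have hb := rep_representative b
        have hc := rep_representative c
        refine ((hb.add hc).pdFun he).eq_of_eq ((hb.pdFun he).add (hc.pdFun he)) fun z hz => ?_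
        exact pd_add hb.1 hc.1 e hz
      map_smul' := fun r b => by
        have hb := rep_representative b
        have h1 := (Rep.const r).mul hb
        have h2 := (Rep.const r).mul (hb.pdFun he)
        rw [← Algebra.smul_def] at h1 h2
        refine (h1.pdFun he).eq_of_eq h2 fun z hz => ?_
        exact ((hb.1.hasDerivAt e hz).const_mul r).deriv }
    (fun b c => by
      have hb := rep_representative b
      have hc := rep_representative c
      exact ((hb.mul hc).pdFun he).eq_of_eq
        ((hb.mul (hc.pdFun he)).add (hc.mul (hb.pdFun he))) fun z hz => pd_mul hb.1 hc.1 e hz)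

theorem Rep.pdDerivation {F : JetFun p q} {b : ApproxAlgebra Ω k} {e : Coord p q}
    (he : e ≠ .eps) (hF : Rep Ω k F b) : Rep Ω k (pd e F) (pdDerivation Ω k e b) := by
  rw [PerturbedHamiltonian.pdDerivation, dif_neg he]
  exact hF.pdFun he

/-- The jet algebra of differential functions up to `o(ε^k)`. -/
def jetAlgebra (Ω : Domain p q) (k : ℕ) {t₀ : ℝ} (ht₀ : t₀ ∈ Ω.T) :
    JetAlgebra p q (ApproxAlgebra Ω k) where
  d := pdDerivation Ω k
  coord c := approxClass Ω k fun z => z c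
  d_coord c e hc := by
    refine (((IsDiffFun.coord e).rep_approxClass k).pdDerivation hc).eq_of_eq
      (G := fun _ => if c = e then 1 else 0) ?_ fun z _ => pd_coord c e z
    split_ifs
    · exact Rep.one
    · exact Rep.zero
  d_comm c e f := by
    by_cases hc : c = .eps
    · simp [pdDerivation, hc]
    by_cases he : e = .eps
    · simp [pdDerivation, he]
    have hf := rep_representative f
    exact ((hf.pdDerivation he).pdDerivation hc).eq_of_eq
      ((hf.pdDerivation hc).pdDerivation he) fun z hz => pd_comm hf.1 c e hz
  finite_support f := by
    have hf := rep_representative f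
    obtain ⟨S, hS⟩ := hf.1.finite_support
    refine S.finite_toSet.subset fun c hc => ?_
    by_contra h
    apply hc
    by_cases he : c = .eps
    · simp [pdDerivation, he]
    · exact (hf.pdDerivation he).eq_of_eq Rep.zero (hS c h)
  initial :=
    -- Only some representative has to vanish at `t₀`; others may differ from it by `o(ε^k)`.
    { carrier := {b | ∃ F, Rep Ω k F b ∧ ∀ z ∈ Ω.carrier, z .time = t₀ → F z = 0}
      zero_mem' := ⟨_, Rep.zero, fun _ _ _ => rfl⟩
      add_mem' := by
        rintro b c ⟨F, hF, hF0⟩ ⟨G, hG, hG0⟩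
        exact ⟨_, hF.add hG, fun z hz h => by simp [hF0 z hz h, hG0 z hz h]⟩
      smul_mem' := by
        rintro b c ⟨G, hG, hG0⟩
        exact ⟨_, (rep_representative b).mul hG, fun z hz h => by simp [hG0 z hz h]⟩ }
  d_mem_initial := by
    rintro c hc f ⟨F, hF, hF0⟩
    by_cases he : c = .eps
    · simp [pdDerivation, he]
    · exact ⟨_, hF.pdDerivation he, fun z hz h => pd_eq_zero_of_slice hc hF0 hz h⟩
  eq_zero_of_mem_initial := by
    rintro f ⟨F, hF, hF0⟩ h
    rw [hF.eq_zero_iff]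
    exact isLittleO_of_pd_time hF.1 ht₀ hF0 ((hF.pdDerivation (by simp)).eq_zero_iff.1 h)
  exists_primitive f := by
    have hf := rep_representative f
    obtain ⟨g, hg⟩ := (hf.1.primitive ht₀).exists_rep k
    refine ⟨g, ⟨_, hg, fun z _ h => primitive_eq_zero _ _ h⟩, ?_⟩
    exact (hg.pdDerivation (by simp)).eq_of_eq hf fun z hz => pd_time_primitive hf.1 ht₀ hz

/-! ### Transport of the operations -/

variable {t₀ : ℝ} (ht₀ : t₀ ∈ Ω.T) {F : JetFun p q} {b : ApproxAlgebra Ω k}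

theorem Rep.d {e : Coord p q} (he : e ≠ .eps) (hF : Rep Ω k F b) :
    Rep Ω k (pd e F) ((jetAlgebra Ω k ht₀).d e b) :=
  hF.pdDerivation he

theorem Rep.u (s : Fin q × MultiIndex p) :
    Rep Ω k (fun z => z (.jet s.1 s.2)) ((jetAlgebra Ω k ht₀).u s) :=
  (IsDiffFun.coord _).rep_approxClass k

theorem IsDiffFun.exists_jet_support (hF : IsDiffFun Ω F) :
    ∃ T : Finset (MultiIndex p), ∀ α, ∀ J ∉ T, ∀ z ∈ Ω.carrier,
      PerturbedHamiltonian.pd (.jet α J) F z = 0 := by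
  obtain ⟨S, hS⟩ := hF.finite_support
  have hfin : (⋃ α : Fin q, {J : MultiIndex p | Coord.jet α J ∈ S}).Finite := by
    refine Set.finite_iUnion fun α => S.finite_toSet.preimage fun J _ J' _ h => ?_
    simpa using h
  refine ⟨hfin.toFinset, fun α J hJ => hS _ fun h => hJ ?_⟩
  simp only [Set.Finite.mem_toFinset, Set.mem_iUnion]
  exact ⟨α, h⟩

theorem Rep.dj_eq_zero (hF : Rep Ω k F b) {s : Fin q × MultiIndex p}
    (h : ∀ z ∈ Ω.carrier, PerturbedHamiltonian.pd (.jet s.1 s.2) F z = 0) :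
    (jetAlgebra Ω k ht₀).dj s b = 0 :=
  (hF.d ht₀ (by simp)).eq_of_eq Rep.zero h

theorem Rep.vert (hF : Rep Ω k F b) {a : Fin q × MultiIndex p → JetFun p q}
    {a' : Fin q × MultiIndex p → ApproxAlgebra Ω k} (ha : ∀ s, Rep Ω k (a s) (a' s)) :
    Rep Ω k (fun z => ∑ α : Fin q, ∑ᶠ J : MultiIndex p, a (α, J) z * pd (.jet α J) F z)
      ((jetAlgebra Ω k ht₀).vert a' b) := by
  obtain ⟨T, hT⟩ := hF.1.exists_jet_support
  rw [(jetAlgebra Ω k ht₀).vert_eq_sum a' (S := Finset.univ ×ˢ T), Finset.sum_product]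
  · refine (Rep.sum Finset.univ fun α _ => Rep.sum T fun J _ =>
      (ha (α, J)).mul (hF.d ht₀ (e := .jet α J) (by simp))).congr fun z hz => ?_
    refine Finset.sum_congr rfl fun α _ => finsum_eq_sum_of_support_subset _ fun J hJ => ?_
    by_contra h
    exact hJ (by simp [hT α J h z hz])
  · rintro ⟨α, J⟩ h
    exact hF.dj_eq_zero ht₀ (hT α J (by simpa using h))

theorem Rep.totalD (hF : Rep Ω k F b) (i : Fin p) :
    Rep Ω k (totalD i F) ((jetAlgebra Ω k ht₀).D i b) :=
  (hF.d ht₀ (by simp)).add (hF.vert ht₀ fun s => Rep.u ht₀ (s.1, s.2 + Pi.single i 1))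

theorem Rep.totalDJ (hF : Rep Ω k F b) (J : MultiIndex p) :
    Rep Ω k (totalDJ J F) ((jetAlgebra Ω k ht₀).DJ J b) := by
  rw [PerturbedHamiltonian.totalDJ, JetAlgebra.DJ]
  induction List.finRange p with
  | nil => exact hF
  | cons i l ih =>
    rw [List.foldr_cons, List.map_cons, List.prod_cons, Module.End.mul_apply]
    induction J i with
    | zero => exact ih
    | succ n ihn =>
      rw [Function.iterate_succ_apply', pow_succ', Module.End.mul_apply]
      exact ihn.totalD ht₀ i

variable {Q : Fin q → JetFun p q} {Q' : Fin q → ApproxAlgebra Ω k}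

theorem Rep.prEvol (hQ : ∀ α, Rep Ω k (Q α) (Q' α)) (hF : Rep Ω k F b) :
    Rep Ω k (prEvol Q F) ((jetAlgebra Ω k ht₀).pr Q' b) :=
  hF.vert ht₀ fun s => (hQ s.1).totalDJ ht₀ s.2

theorem Rep.totalDt (hQ : ∀ α, Rep Ω k (Q α) (Q' α)) (hF : Rep Ω k F b) :
    Rep Ω k (totalDt Q F) ((jetAlgebra Ω k ht₀).Dt Q' b) :=
  (hF.d ht₀ (by simp)).add (hF.prEvol ht₀ hQ)

theorem Rep.totalDiv {X : Fin p → JetFun p q} {X' : Fin p → ApproxAlgebra Ω k}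
    (hX : ∀ i, Rep Ω k (X i) (X' i)) :
    Rep Ω k (totalDiv X) ((jetAlgebra Ω k ht₀).div X') := by
  rw [JetAlgebra.div_apply]
  exact Rep.sum _ fun i _ => (hX i).totalD ht₀ i

theorem Rep.neg_one_pow_mul (hF : Rep Ω k F b) (n : ℕ) :
    Rep Ω k (fun z => (-1 : ℝ) ^ n * F z) ((-1) ^ n * b) := by
  simpa using (Rep.const ((-1) ^ n)).mul hF

theorem totalD_congr {F G : JetFun p q} (h : ∀ z ∈ Ω.carrier, F z = G z) (i : Fin p) :
    ∀ z ∈ Ω.carrier, totalD i F z = totalD i G z := by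
  intro z hz
  simp only [totalD, pd_congr h _ z hz]

/-- Partial derivatives outside the support vanish only over the domain, so cutting the Euler sum to
finitely many terms needs this local form of `D_J 0 = 0`. -/
theorem totalDJ_eq_zero {F : JetFun p q} (h : ∀ z ∈ Ω.carrier, F z = 0) (J : MultiIndex p) :
    ∀ z ∈ Ω.carrier, totalDJ J F z = 0 := by
  rw [totalDJ]
  induction List.finRange p with
  | nil => exact h
  | cons i l ih =>
    rw [List.foldr_cons]
    induction J i with
    | zero => exact ih
    | succ n ihn =>
      intro z hz
      rw [Function.iterate_succ_apply', totalD_congr (G := fun _ => 0) ihn i z hz]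
      simp [totalD, pd_const]

theorem Rep.euler (hF : Rep Ω k F b) (α : Fin q) :
    Rep Ω k (euler F α) ((jetAlgebra Ω k ht₀).euler b α) := by
  obtain ⟨T, hT⟩ := hF.1.exists_jet_support
  rw [(jetAlgebra Ω k ht₀).euler_eq_sum (T := T)]
  · refine (Rep.sum T fun J _ => (((hF.d ht₀ (e := .jet α J) (by simp)).totalDJ ht₀
      J).neg_one_pow_mul _)).congr fun z hz => ?_
    refine finsum_eq_sum_of_support_subset _ fun J hJ => ?_
    by_contra h
    apply hJ
    simp only
    rw [totalDJ_eq_zero (hT α J h) J z hz, mul_zero]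
  · intro J hJ
    exact hF.dj_eq_zero ht₀ (hT α J hJ)

/-! ### Functionals and matrix differential operators -/

theorem functionalApprox_iff {F G : JetFun p q} {b c : ApproxAlgebra Ω k} (hF : Rep Ω k F b)
    (hG : Rep Ω k G c) :
    FunctionalApprox Ω k F G ↔ b - c ∈ (jetAlgebra Ω k ht₀).divRange := by
  constructor
  · rintro ⟨X, hX, h⟩
    choose X' hX' using fun i => (hX i).exists_rep k
    refine ⟨X', ?_⟩
    have := ((hF.sub hG).sub (Rep.totalDiv ht₀ hX')).eq_zero_iff.2 h
    exact (sub_eq_zero.1 this).symm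
  · rintro ⟨X', h⟩
    refine ⟨fun i => representative (X' i), fun i => (rep_representative _).1, ?_⟩
    have := (hF.sub hG).sub (Rep.totalDiv ht₀ fun i => rep_representative (X' i))
    exact this.eq_zero_iff.1 (by rw [h, sub_self])

/-- A matrix differential operator acting on classes of differential functions. -/
def operator (𝒟 : MatDiffOp p q) :
    (Fin q → ApproxAlgebra Ω k) →+ (Fin q → ApproxAlgebra Ω k) where
  toFun Q α := ∑ β, ∑ J ∈ (𝒟 α β).support,
    approxClass Ω k (𝒟 α β J) * (jetAlgebra Ω k ht₀).DJ J (Q β)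
  map_zero' := by
    ext α
    simp
  map_add' Q R := by
    ext α
    simp [mul_add, Finset.sum_add_distrib]

theorem operator_apply (𝒟 : MatDiffOp p q) (Q : Fin q → ApproxAlgebra Ω k) (α : Fin q) :
    operator ht₀ 𝒟 Q α = ∑ β, ∑ J ∈ (𝒟 α β).support,
      approxClass Ω k (𝒟 α β J) * (jetAlgebra Ω k ht₀).DJ J (Q β) :=
  rfl

theorem Rep.apply {𝒟 : MatDiffOp p q} (h𝒟 : IsMatDiffOp Ω 𝒟)
    (hQ : ∀ α, Rep Ω k (Q α) (Q' α)) (α : Fin q) :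
    Rep Ω k (𝒟.apply Q α) (operator ht₀ 𝒟 Q' α) :=
  Rep.sum _ fun β _ => Rep.sum _ fun J _ =>
    ((h𝒟 α β J).1.rep_approxClass k).mul ((hQ β).totalDJ ht₀ J)

theorem Rep.bracket {𝒟 : MatDiffOp p q} (h𝒟 : IsMatDiffOp Ω 𝒟) {G : JetFun p q}
    {c : ApproxAlgebra Ω k} (hF : Rep Ω k F b) (hG : Rep Ω k G c) :
    Rep Ω k (bracket 𝒟 F G) ((jetAlgebra Ω k ht₀).bracket (operator ht₀ 𝒟) b c) :=
  Rep.sum _ fun α _ => (hF.euler ht₀ α).mul (Rep.apply ht₀ h𝒟 (fun β => hG.euler ht₀ β) α)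

theorem pd_time_of_isAutonomous (hF : IsAutonomous Ω F) :
    ∀ z ∈ Ω.carrier, pd .time F z = 0 := by
  intro z hz
  have : (fun s => F (Function.update z .time s)) =ᶠ[𝓝 (z .time)] fun _ => F z := by
    filter_upwards [Ω.isOpen_T.mem_nhds hz.1] with s hs using hF z hz s hs
  rw [pd, this.deriv_eq, deriv_const]

theorem d_time_operator {𝒟 : MatDiffOp p q} (h𝒟 : IsMatDiffOp Ω 𝒟)
    (Q : Fin q → ApproxAlgebra Ω k) (α : Fin q) :
    (jetAlgebra Ω k ht₀).d .time (operator ht₀ 𝒟 Q α) =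
      operator ht₀ 𝒟 (fun β => (jetAlgebra Ω k ht₀).d .time (Q β)) α := by
  rw [operator_apply, operator_apply, map_sum]
  refine Finset.sum_congr rfl fun β _ => ?_
  rw [map_sum]
  refine Finset.sum_congr rfl fun J _ => ?_
  have h : (jetAlgebra Ω k ht₀).d .time (approxClass Ω k (𝒟 α β J)) = 0 :=
    (((h𝒟 α β J).1.rep_approxClass k).d ht₀ (by simp)).eq_of_eq Rep.zero
      (pd_time_of_isAutonomous (h𝒟 α β J).2)
  rw [Derivation.leibniz, h, smul_zero, add_zero, JetAlgebra.d_time_DJ, smul_eq_mul]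

theorem operator_mem_initial (𝒟 : MatDiffOp p q) {Q : Fin q → ApproxAlgebra Ω k}
    (hQ : ∀ β, Q β ∈ (jetAlgebra Ω k ht₀).initial) (α : Fin q) :
    operator ht₀ 𝒟 Q α ∈ (jetAlgebra Ω k ht₀).initial := by
  rw [operator_apply]
  exact sum_mem fun β _ => sum_mem fun J _ => Ideal.mul_mem_left _ _ ((jetAlgebra Ω k ht₀).DJ_mem_initial J (hQ β))

end approxAlgebra

end PerturbedHamiltonian

end

/-! ### Transport of the exact correspondence back to differential functions. -/

theorem mainTheorem3 {p q : ℕ} (Ω : PerturbedHamiltonian.Domain p q) (k : ℕ)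
    (𝒟 : PerturbedHamiltonian.MatDiffOp p q)
    (h𝒟 : PerturbedHamiltonian.IsApproxHamiltonianOp Ω k 𝒟)
    (H : PerturbedHamiltonian.JetFun p q)
    (hH : PerturbedHamiltonian.IsDiffFun Ω H)
    (hHt : PerturbedHamiltonian.IsAutonomous Ω H)
    (P : PerturbedHamiltonian.JetFun p q)
    (hP : PerturbedHamiltonian.IsDiffFun Ω P) :
    PerturbedHamiltonian.IsApproxSymmetry Ω k
        (𝒟.apply (PerturbedHamiltonian.euler H)) (𝒟.apply (PerturbedHamiltonian.euler P)) ↔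
      ∃ G P' : PerturbedHamiltonian.JetFun p q,
        PerturbedHamiltonian.IsDiffFun Ω G ∧
        PerturbedHamiltonian.IsDiffFun Ω P' ∧
        PerturbedHamiltonian.IsApproxDistinguished Ω k 𝒟 G ∧
        PerturbedHamiltonian.FunctionalApprox Ω k P' (fun z => P z - G z) ∧
        PerturbedHamiltonian.IsApproxConservationLaw Ω k
          (𝒟.apply (PerturbedHamiltonian.euler H)) P' := by
  open PerturbedHamiltonian in
  obtain ⟨t₀, ht₀⟩ := Ω.isConnected_T.nonempty
  have hM := h𝒟.isMatDiffOp
  obtain ⟨h, hh⟩ := hH.exists_rep k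
  obtain ⟨b, hb⟩ := hP.exists_rep k
  have hδ : ∀ {F c}, Rep Ω k F c → ∀ α, Rep Ω k (𝒟.apply (euler F) α)
      (operator ht₀ 𝒟 ((jetAlgebra Ω k ht₀).euler c) α) :=
    fun hF => Rep.apply ht₀ hM fun β => hF.euler ht₀ β
  -- Every class has a representative, so the approximate bracket identities for differential
  -- functions give the exact identities modulo divergences in the quotient.
  have main := (jetAlgebra Ω k ht₀).noether (𝒟 := operator ht₀ 𝒟)
    (fun x y => by
      have hx := rep_representative x
      have hy := rep_representative y
      have := (functionalApprox_iff ht₀ (hx.bracket ht₀ hM hy) (hy.bracket ht₀ hM hx).neg).1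
        (h𝒟.skew _ _ hx.1 hy.1)
      rwa [sub_neg_eq_add] at this)
    (fun x y w => by
      have hx := rep_representative x
      have hy := rep_representative y
      have hw := rep_representative w
      have := (functionalApprox_iff ht₀
        ((((hx.bracket ht₀ hM hy).bracket ht₀ hM hw).add
          ((hy.bracket ht₀ hM hw).bracket ht₀ hM hx)).add
          ((hw.bracket ht₀ hM hx).bracket ht₀ hM hy)) Rep.zero).1
        (h𝒟.jacobi _ _ _ hx.1 hy.1 hw.1)
      rwa [sub_zero] at this)
    (d_time_operator ht₀ hM) (fun Q hQ => operator_mem_initial ht₀ 𝒟 hQ) h b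
  have hcons : ∀ {F c}, Rep Ω k F c → (IsApproxConservationLaw Ω k (𝒟.apply (euler H)) F ↔
      (jetAlgebra Ω k ht₀).Dt (operator ht₀ 𝒟 ((jetAlgebra Ω k ht₀).euler h)) c ∈
        (jetAlgebra Ω k ht₀).divRange) := by
    intro F c hF
    have hDt := hF.totalDt ht₀ (hδ hh)
    constructor
    · rintro ⟨X, hX, hXF⟩
      choose X' hX' using fun i => (hX i).exists_rep k
      have := (hDt.add (Rep.totalDiv ht₀ hX')).eq_zero_iff.2 hXF
      rw [eq_neg_of_add_eq_zero_left this]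
      exact neg_mem ⟨X', rfl⟩
    · intro hmem
      obtain ⟨X', hX'⟩ := neg_mem hmem
      refine ⟨fun i => representative (X' i), fun i => (rep_representative _).1, ?_⟩
      have := hDt.add (Rep.totalDiv ht₀ fun i => rep_representative (X' i))
      exact this.eq_zero_iff.1 (by rw [hX', add_neg_cancel])
  have hsym : IsApproxSymmetry Ω k (𝒟.apply (euler H)) (𝒟.apply (euler P)) ↔ _ :=
    forall_congr' fun ν => (((hδ hb ν).totalDt ht₀ (hδ hh)).sub
      ((hδ hh ν).prEvol ht₀ (hδ hb))).eq_zero_iff.symm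
  rw [hsym, main]
  constructor
  · rintro ⟨g, c, hg, hc, hc'⟩
    have hG := rep_representative g
    have hP' := rep_representative c
    exact ⟨_, _, hG.1, hP'.1, fun α => (hδ hG α).eq_zero_iff.1 (hg α),
      (functionalApprox_iff ht₀ hP' (hb.sub hG)).2 hc, (hcons hP').2 hc'⟩
  · rintro ⟨G, P', hG, hP', hdist, happrox, hlaw⟩
    obtain ⟨g, hg⟩ := hG.exists_rep k
    obtain ⟨c, hc⟩ := hP'.exists_rep k
    exact ⟨g, c, fun α => (hδ hg α).eq_zero_iff.2 (hdist α),
      (functionalApprox_iff ht₀ hc (hb.sub hg)).1 happrox, (hcons hc).1 hlaw⟩
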